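/- Let $X$ be a real or complex Banach space. Write $\mathcal F(Y,Z)$ for the normed space (operator norm) of continuous finite-rank operators $Y\to Z$, $\mathcal F(Y)=\mathcal F(Y,Y)$, $\widehat\otimes$ for the completed projective tensor product and $\|\cdot\|_\wedge$ for its norm, and let $\mathcal A(X)$ be the Banach algebra of approximable operators on $X$, i.e. the operator-norm closure of $\mathcal F(X)$ in the bounded operators on $X$. A Banach algebra $\mathcal A$ is called amenable if for every Banach $\mathcal A$-bimodule $E$ (a Banach space with bounded bilinear, commuting left and right actions of $\mathcal A$) every continuous derivation $D:\mathcal A\to E^*$ is inner, where $(a\cdot f)(x)=f(x\cdot a)$ and $(f\cdot a)(x)=f(a\cdot x)$. For finite-dimensional normed spaces $Y,Z$, an element $\Delta\in\mathcal F(Z,Y)\widehat\otimes\mathcal F(Y,Z)$ is a generalized diagonal for $\mathcal F(Y)$ if $W\Delta=\Delta W$ and $\pi(\Delta)W=W$ for every $W\in\mathcal F(Y)$, where $W(U\otimes V)=WU\otimes V$, $(U\otimes V)W=U\otimes VW$ and $\pi(U\otimes V)=UV$. Suppose that $\mathcal A(X)$ contains a bounded net of projections $(P_\alpha)_{\alpha\in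 A}$ such that $P_\alpha x\to x$ for every $x\in X$ and $P_\alpha^*x^*\to x^*$ in norm for every $x^*\in X^*$. Let $X_\alpha=P_\alpha(X)$ with the norm of $X$; these spaces are finite-dimensional. Then $\mathcal A(X)$ is amenable if and only if there is a constant $K>0$ such that for every $\alpha\in A$ there exists $\beta\in A$ such that $\mathcal F(X_\beta,X_\alpha)\widehat\otimes\mathcal F(X_\alpha,X_\beta)$ contains a generalized diagonal $\Delta$ for $\mathcal F(X_\alpha)$ with $\|\Delta\|_\wedge\le K$. -/

import Mathlib

open scoped TensorProduct Topology

namespace GenDiag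

noncomputable section

universe u v

/-! ### Amenability of Banach algebras -/

/-- A Banach `A`-bimodule structure on a Banach space `E`: bounded bilinear actions
`a · x = left a x` and `x · a = right a x`, each associative, that commute with each other.
The algebra `A` need not have a unit. -/
structure BanachBimodule (𝕜 : Type v) [RCLike 𝕜] (A : Type u) [NonUnitalNormedRing A]
    [NormedSpace 𝕜 A] (E : Type*) [NormedAddCommGroup E] [NormedSpace 𝕜 E] where
  left : A →L[𝕜] E →L[𝕜] E
  right : A →L[𝕜] E →L[𝕜] E
  left_mul : ∀ (a b : A) (x : E), left (a * b) x = left a (left b x)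
  right_mul : ∀ (a b : A) (x : E), right (a * b) x = right b (right a x)
  left_right : ∀ (a b : A) (x : E), left a (right b x) = right b (left a x)

namespace BanachBimodule

variable {𝕜 : Type v} [RCLike 𝕜] {A : Type u} [NonUnitalNormedRing A] [NormedSpace 𝕜 A]
  {E : Type*} [NormedAddCommGroup E] [NormedSpace 𝕜 E]

/-- The left action on the dual module: `(a · f)(x) = f (x · a)`. -/
def dualLeft (M : BanachBimodule 𝕜 A E) (a : A) (f : StrongDual 𝕜 E) : StrongDual 𝕜 E :=
  f.comp (M.right a)

/-- The right action on the dual module: `(f · a)(x) = f (a · x)`. -/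
def dualRight (M : BanachBimodule 𝕜 A E) (f : StrongDual 𝕜 E) (a : A) : StrongDual 𝕜 E :=
  f.comp (M.left a)

end BanachBimodule

/-- A Banach algebra `A` is amenable if, for every Banach `A`-bimodule `E`, every continuous
derivation from `A` to the dual module of `E` is inner. -/
def IsAmenable (𝕜 : Type v) [RCLike 𝕜] (A : Type u) [NonUnitalNormedRing A]
    [NormedSpace 𝕜 A] : Prop :=
  ∀ (E : Type (max u v)) [NormedAddCommGroup E] [NormedSpace 𝕜 E] [CompleteSpace E]
    (M : BanachBimodule 𝕜 A E) (D : A →L[𝕜] StrongDual 𝕜 E),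
    (∀ a b : A, D (a * b) = M.dualRight (D a) b + M.dualLeft a (D b)) →
      ∃ f : StrongDual 𝕜 E, ∀ a : A, D a = M.dualLeft a f - M.dualRight f a

/-! ### The projective tensor product of two normed spaces -/

section Projective

variable (𝕜 : Type*) [RCLike 𝕜] (E F : Type*) [NormedAddCommGroup E] [NormedSpace 𝕜 E]
  [NormedAddCommGroup F] [NormedSpace 𝕜 F]

/-- The algebraic tensor product `E ⊗ F`, to be endowed with the projective norm. -/
def AlgTensor : Type _ := E ⊗[𝕜] F

instance : AddCommGroup (AlgTensor 𝕜 E F) := inferInstanceAs (AddCommGroup (E ⊗[𝕜] F))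

instance : Module 𝕜 (AlgTensor 𝕜 E F) := inferInstanceAs (Module 𝕜 (E ⊗[𝕜] F))

/-- The identification of `E ⊗ F` with its normed copy. -/
def toAlg : E ⊗[𝕜] F ≃ₗ[𝕜] AlgTensor 𝕜 E F := LinearEquiv.refl 𝕜 (E ⊗[𝕜] F)

variable {E F}

/-- The tensor `∑ xᵢ ⊗ yᵢ` represented by a finite list of pairs `(xᵢ, yᵢ)`. -/
def tensorSum (l : List (E × F)) : AlgTensor 𝕜 E F :=
  (l.map fun p => toAlg 𝕜 E F (p.1 ⊗ₜ[𝕜] p.2)).sum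

/-- The cost `∑ ‖xᵢ‖ ‖yᵢ‖` of a finite list of pairs `(xᵢ, yᵢ)`. -/
def tensorCost (l : List (E × F)) : ℝ := (l.map fun p => ‖p.1‖ * ‖p.2‖).sum

theorem tensorCost_nonneg (l : List (E × F)) : 0 ≤ tensorCost l := by
  refine List.sum_nonneg fun a ha => ?_
  obtain ⟨p, -, rfl⟩ := List.mem_map.1 ha
  positivity

theorem exists_tensorSum (t : AlgTensor 𝕜 E F) : ∃ l : List (E × F), tensorSum 𝕜 l = t := by
  obtain ⟨t, rfl⟩ := (toAlg 𝕜 E F).surjective t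
  induction t using TensorProduct.induction_on with
  | zero => exact ⟨[], by simp [tensorSum]⟩
  | tmul x y => exact ⟨[(x, y)], by simp [tensorSum]⟩
  | add s t hs ht =>
    obtain ⟨l, hl⟩ := hs
    obtain ⟨m, hm⟩ := ht
    exact ⟨l ++ m, by simp [tensorSum, ← hl, ← hm]⟩

/-- The projective norm: the infimum of `∑ ‖xᵢ‖ ‖yᵢ‖` over all finite representations
`t = ∑ xᵢ ⊗ yᵢ`. -/
def projNorm (t : AlgTensor 𝕜 E F) : ℝ :=
  ⨅ l : {l : List (E × F) // tensorSum 𝕜 l = t}, tensorCost l.1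

theorem projNorm_le (l : List (E × F)) : projNorm 𝕜 (tensorSum 𝕜 l) ≤ tensorCost l :=
  ciInf_le (f := fun m : {m : List (E × F) // tensorSum 𝕜 m = tensorSum 𝕜 l} => tensorCost m.1)
    ⟨0, by rintro _ ⟨m, rfl⟩; exact tensorCost_nonneg m.1⟩ ⟨l, rfl⟩

theorem le_projNorm {t : AlgTensor 𝕜 E F} {c : ℝ}
    (h : ∀ l : List (E × F), tensorSum 𝕜 l = t → c ≤ tensorCost l) : c ≤ projNorm 𝕜 t := by
  obtain ⟨l, hl⟩ := exists_tensorSum 𝕜 t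
  have : Nonempty {l : List (E × F) // tensorSum 𝕜 l = t} := ⟨⟨l, hl⟩⟩
  exact le_ciInf fun m => h m.1 m.2

theorem le_mul_projNorm {t : AlgTensor 𝕜 E F} {c d : ℝ} (hd : 0 ≤ d)
    (h : ∀ l : List (E × F), tensorSum 𝕜 l = t → c ≤ d * tensorCost l) :
    c ≤ d * projNorm 𝕜 t := by
  obtain ⟨l, hl⟩ := exists_tensorSum 𝕜 t
  have : Nonempty {l : List (E × F) // tensorSum 𝕜 l = t} := ⟨⟨l, hl⟩⟩
  rw [projNorm, Real.mul_iInf_of_nonneg hd]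
  exact le_ciInf fun m => h m.1 m.2

theorem projNorm_add_le (s t : AlgTensor 𝕜 E F) :
    projNorm 𝕜 (s + t) ≤ projNorm 𝕜 s + projNorm 𝕜 t := by
  rw [← sub_le_iff_le_add]
  refine le_projNorm 𝕜 fun l hl => ?_
  rw [sub_le_comm]
  refine le_projNorm 𝕜 fun m hm => ?_
  rw [sub_le_iff_le_add]
  have h : tensorSum 𝕜 (l ++ m) = s + t := by simp [tensorSum, ← hl, ← hm]
  rw [← h]
  refine (projNorm_le 𝕜 (l ++ m)).trans (le_of_eq ?_)
  simp [tensorCost, add_comm]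

theorem projNorm_smul_le (c : 𝕜) (t : AlgTensor 𝕜 E F) :
    projNorm 𝕜 (c • t) ≤ ‖c‖ * projNorm 𝕜 t := by
  refine le_mul_projNorm 𝕜 (norm_nonneg c) fun l hl => ?_
  have h1 : tensorSum 𝕜 (l.map fun p => (c • p.1, p.2)) = c • t := by
    rw [← hl, tensorSum, tensorSum, List.smul_sum]
    simp [Function.comp_def, ← TensorProduct.smul_tmul']
  have h2 : tensorCost (l.map fun p => (c • p.1, p.2)) = ‖c‖ * tensorCost l := by
    simp [tensorCost, Function.comp_def, norm_smul, mul_assoc, List.sum_map_mul_left]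
  rw [← h1, ← h2]
  exact projNorm_le 𝕜 _

variable (E F) in
/-- The projective norm as a seminorm on the algebraic tensor product. -/
def projSeminorm : Seminorm 𝕜 (AlgTensor 𝕜 E F) :=
  .ofSMulLE (projNorm 𝕜)
    (le_antisymm (projNorm_le 𝕜 ([] : List (E × F)))
      (le_projNorm 𝕜 fun l _ => tensorCost_nonneg l))
    (projNorm_add_le 𝕜) (projNorm_smul_le 𝕜)

instance : SeminormedAddCommGroup (AlgTensor 𝕜 E F) :=
  AddGroupSeminorm.toSeminormedAddCommGroup (projSeminorm 𝕜 E F).toAddGroupSeminorm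

theorem norm_eq_projNorm (t : AlgTensor 𝕜 E F) : ‖t‖ = projNorm 𝕜 t := rfl

instance : NormedSpace 𝕜 (AlgTensor 𝕜 E F) := ⟨projNorm_smul_le 𝕜⟩

variable (E F) in
/-- The projective tensor product of `E` and `F`: the completion of the algebraic tensor product
for the projective norm. -/
abbrev ProjTensor : Type _ := UniformSpace.Completion (AlgTensor 𝕜 E F)

/-- The elementary tensor `x ⊗ y` in the projective tensor product. -/
def ptmul (x : E) (y : F) : ProjTensor 𝕜 E F :=
  (toAlg 𝕜 E F (x ⊗ₜ[𝕜] y) : AlgTensor 𝕜 E F)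

variable {𝕜} {G : Type*} [NormedAddCommGroup G] [NormedSpace 𝕜 G]

/-- The bounded linear map on the algebraic tensor product given by a bounded bilinear map. -/
def algLift (B : E →L[𝕜] F →L[𝕜] G) : AlgTensor 𝕜 E F →L[𝕜] G :=
  LinearMap.mkContinuous
    ((TensorProduct.lift ((ContinuousLinearMap.coeLM 𝕜).comp B.toLinearMap)).comp
      (toAlg 𝕜 E F).symm.toLinearMap)
    ‖B‖ (by
      intro t
      refine le_mul_projNorm 𝕜 (norm_nonneg B) ?_
      rintro l rfl
      unfold tensorSum tensorCost
      induction l with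
      | nil => simp
      | cons p l ih =>
        simp only [List.map_cons, List.sum_cons, map_add, mul_add]
        refine (norm_add_le _ _).trans (add_le_add ?_ ih)
        simpa [mul_assoc] using B.le_opNorm₂ p.1 p.2)

theorem algLift_tmul (B : E →L[𝕜] F →L[𝕜] G) (x : E) (y : F) :
    algLift B (toAlg 𝕜 E F (x ⊗ₜ[𝕜] y)) = B x y := by
  change TensorProduct.lift ((ContinuousLinearMap.coeLM 𝕜).comp B.toLinearMap) (x ⊗ₜ[𝕜] y) = _
  simp

/-- The bounded linear map on the projective tensor product determined by a bounded bilinear map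
`B` with values in a Banach space, `x ⊗ y ↦ B x y`. -/
def projLift [CompleteSpace G] (B : E →L[𝕜] F →L[𝕜] G) : ProjTensor 𝕜 E F →L[𝕜] G :=
  (algLift B).extend UniformSpace.Completion.toComplL

theorem projLift_coe [CompleteSpace G] (B : E →L[𝕜] F →L[𝕜] G) (t : AlgTensor 𝕜 E F) :
    projLift B (t : ProjTensor 𝕜 E F) = algLift B t :=
  (algLift B).extend_eq (e := UniformSpace.Completion.toComplL)
    UniformSpace.Completion.denseRange_coe
    (UniformSpace.Completion.isUniformInducing_coe _) t

theorem projLift_ptmul [CompleteSpace G] (B : E →L[𝕜] F →L[𝕜] G) (x : E) (y : F) :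
    projLift B (ptmul 𝕜 x y) = B x y := by
  rw [ptmul, projLift_coe, algLift_tmul]

variable (𝕜 E F) in
/-- The canonical bounded bilinear map `(x, y) ↦ x ⊗ y` into the projective tensor product. -/
def ptmulL : E →L[𝕜] F →L[𝕜] ProjTensor 𝕜 E F :=
  LinearMap.mkContinuous₂
    ((TensorProduct.mk 𝕜 E F).compr₂
      ((UniformSpace.Completion.toComplL :
          AlgTensor 𝕜 E F →L[𝕜] ProjTensor 𝕜 E F).toLinearMap.comp
        (toAlg 𝕜 E F).toLinearMap)) 1 (by
      intro x y
      have h := projNorm_le 𝕜 [(x, y)]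
      simpa [tensorSum, tensorCost, ← norm_eq_projNorm] using h)

theorem ptmulL_apply (x : E) (y : F) : ptmulL 𝕜 E F x y = ptmul 𝕜 x y := by
  simp [ptmulL, ptmul]

variable {E' F' : Type*} [NormedAddCommGroup E'] [NormedSpace 𝕜 E']
  [NormedAddCommGroup F'] [NormedSpace 𝕜 F']

/-- The tensor product `S ⊗ T` of two bounded operators, `x ⊗ y ↦ S x ⊗ T y`. -/
def projMap (S : E →L[𝕜] E') (T : F →L[𝕜] F') : ProjTensor 𝕜 E F →L[𝕜] ProjTensor 𝕜 E' F' :=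
  projLift ((ptmulL 𝕜 E' F').bilinearComp S T)

theorem projMap_ptmul (S : E →L[𝕜] E') (T : F →L[𝕜] F') (x : E) (y : F) :
    projMap S T (ptmul 𝕜 x y) = ptmul 𝕜 (S x) (T y) := by
  unfold projMap
  rw [projLift_ptmul, ContinuousLinearMap.bilinearComp_apply, ptmulL_apply]

end Projective

/-! ### Finite-rank and approximable operators -/

section Operators

variable (𝕜 : Type*) [RCLike 𝕜]

/-- The normed space `F(X, Y)` of continuous finite-rank operators, with the operator norm. -/
def finiteRank (X Y : Type*) [NormedAddCommGroup X] [NormedSpace 𝕜 X]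
    [NormedAddCommGroup Y] [NormedSpace 𝕜 Y] : Submodule 𝕜 (X →L[𝕜] Y) where
  carrier := {T | FiniteDimensional 𝕜 (LinearMap.range T.toLinearMap)}
  zero_mem' := by
    change FiniteDimensional 𝕜 (LinearMap.range (0 : X →ₗ[𝕜] Y))
    rw [LinearMap.range_zero]
    infer_instance
  add_mem' := by
    intro S T hS hT
    have : FiniteDimensional 𝕜 (LinearMap.range S.toLinearMap) := hS
    have : FiniteDimensional 𝕜 (LinearMap.range T.toLinearMap) := hT
    exact Submodule.finiteDimensional_of_le
      (LinearMap.range_add_le S.toLinearMap T.toLinearMap)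
  smul_mem' := by
    intro c T hT
    have : FiniteDimensional 𝕜 (LinearMap.range T.toLinearMap) := hT
    refine Submodule.finiteDimensional_of_le (S₂ := LinearMap.range T.toLinearMap) ?_
    rintro _ ⟨x, rfl⟩
    exact ⟨c • x, by simp⟩

variable {𝕜} {X Y Z : Type*} [NormedAddCommGroup X] [NormedSpace 𝕜 X]
  [NormedAddCommGroup Y] [NormedSpace 𝕜 Y] [NormedAddCommGroup Z] [NormedSpace 𝕜 Z]

theorem comp_mem_finiteRank_left (W : Y →L[𝕜] Z) {T : X →L[𝕜] Y} (hT : T ∈ finiteRank 𝕜 X Y) :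
    W.comp T ∈ finiteRank 𝕜 X Z := by
  have : FiniteDimensional 𝕜 (LinearMap.range T.toLinearMap) := hT
  change FiniteDimensional 𝕜 (LinearMap.range (W.toLinearMap.comp T.toLinearMap))
  rw [LinearMap.range_comp]
  infer_instance

theorem comp_mem_finiteRank_right {T : Y →L[𝕜] Z} (hT : T ∈ finiteRank 𝕜 Y Z) (W : X →L[𝕜] Y) :
    T.comp W ∈ finiteRank 𝕜 X Z := by
  have : FiniteDimensional 𝕜 (LinearMap.range T.toLinearMap) := hT
  exact Submodule.finiteDimensional_of_le
    (LinearMap.range_comp_le_range W.toLinearMap T.toLinearMap)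

/-- Composition on the left, `T ↦ W T`, from `F(X, Y)` to `F(X, Z)`. -/
def postcomp (W : Y →L[𝕜] Z) : finiteRank 𝕜 X Y →L[𝕜] finiteRank 𝕜 X Z :=
  ((ContinuousLinearMap.compL 𝕜 X Y Z W).comp (finiteRank 𝕜 X Y).subtypeL).codRestrict
    (finiteRank 𝕜 X Z) fun T => comp_mem_finiteRank_left W T.2

/-- Composition on the right, `T ↦ T W`, from `F(Y, Z)` to `F(X, Z)`. -/
def precomp (W : X →L[𝕜] Y) : finiteRank 𝕜 Y Z →L[𝕜] finiteRank 𝕜 X Z :=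
  (((ContinuousLinearMap.compL 𝕜 X Y Z).flip W).comp (finiteRank 𝕜 Y Z).subtypeL).codRestrict
    (finiteRank 𝕜 X Z) fun T => comp_mem_finiteRank_right T.2 W

variable (𝕜 X) in
/-- The algebra `F(X)` of continuous finite-rank operators on `X`. -/
def finiteRankAlg : NonUnitalSubalgebra 𝕜 (X →L[𝕜] X) :=
  { finiteRank 𝕜 X X with
    mul_mem' := fun {S _} _ hT => comp_mem_finiteRank_left S hT }

variable (𝕜 X) in
/-- The algebra `A(X)` of approximable operators on `X`: the closure of `F(X)` in the operator
norm. -/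
def approximable : NonUnitalSubalgebra 𝕜 (X →L[𝕜] X) := (finiteRankAlg 𝕜 X).topologicalClosure

instance : NormedSpace 𝕜 (approximable 𝕜 X) := ⟨fun c T => norm_smul_le c T.1⟩

variable (𝕜 X) in
/-- The projections in `A(X)`. -/
abbrev ApproxProj : Type _ := {p : approximable 𝕜 X // IsIdempotentElem p}

namespace ApproxProj

/-- A projection in `A(X)`, as an operator on `X`. -/
def op (p : ApproxProj 𝕜 X) : X →L[𝕜] X := p.1.1

/-- The range of a projection in `A(X)`, a subspace of `X` with the norm of `X`. -/
def rg (p : ApproxProj 𝕜 X) : Submodule 𝕜 X := LinearMap.range p.op.toLinearMap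

theorem op_apply_of_mem (p : ApproxProj 𝕜 X) {x : X} (hx : x ∈ p.rg) : p.op x = x := by
  obtain ⟨y, rfl⟩ := hx
  have h : p.op * p.op = p.op := congrArg Subtype.val p.2
  exact congrArg (fun T : X →L[𝕜] X => T y) h

/-- The range of an approximable projection on a Banach space is finite-dimensional. -/
instance finiteDimensional_rg [CompleteSpace X] (p : ApproxProj 𝕜 X) :
    FiniteDimensional 𝕜 p.rg := by
  have hfin : ∀ T ∈ finiteRankAlg 𝕜 X, IsCompactOperator T := by
    intro T hT
    have : FiniteDimensional 𝕜 (LinearMap.range T.toLinearMap) := hT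
    have : ProperSpace (LinearMap.range T.toLinearMap) := FiniteDimensional.proper 𝕜 _
    have h1 : IsCompactOperator
        (T.codRestrict (LinearMap.range T.toLinearMap) fun x => ⟨x, rfl⟩) :=
      isCompactOperator_of_locallyCompactSpace_dom _
    exact h1.clm_comp (LinearMap.range T.toLinearMap).subtypeL
  have hcomp : IsCompactOperator p.op :=
    closure_minimal hfin isClosed_setOfPred_isCompactOperator p.1.2
  have hcl : IsClosed (p.rg : Set X) := by
    have : (p.rg : Set X) = {x | p.op x = x} :=
      Set.ext fun x => ⟨fun hx => p.op_apply_of_mem hx, fun hx => ⟨x, hx⟩⟩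
    rw [this]
    exact isClosed_eq p.op.continuous continuous_id
  obtain ⟨K, hK, hsub⟩ := hcomp.image_closedBall_subset_compact (f := p.op.toLinearMap) 1
  refine FiniteDimensional.of_isCompact_closedBall₀ 𝕜 zero_lt_one ?_
  have hemb : Topology.IsClosedEmbedding ((↑) : p.rg → X) := hcl.isClosedEmbedding_subtypeVal
  refine (hemb.isCompact_preimage hK).of_isClosed_subset Metric.isClosed_closedBall ?_
  intro x hx
  refine hsub ⟨x, ?_, p.op_apply_of_mem x.2⟩
  simpa using hx

end ApproxProj

/-! ### Generalized diagonals -/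

variable (𝕜 X Y) in
/-- The product map `π`, `U ⊗ V ↦ U V`, on the projective tensor product of `F(Y, X)` and
`F(X, Y)`. Its values are regarded as operators on `X`. -/
def prodMap [CompleteSpace X] :
    ProjTensor 𝕜 (finiteRank 𝕜 Y X) (finiteRank 𝕜 X Y) →L[𝕜] (X →L[𝕜] X) :=
  projLift ((ContinuousLinearMap.compL 𝕜 X Y X).bilinearComp
    (finiteRank 𝕜 Y X).subtypeL (finiteRank 𝕜 X Y).subtypeL)

/-- The left action of operators on `X`, `W (U ⊗ V) = W U ⊗ V`. -/
def leftAct (W : X →L[𝕜] X) (Δ : ProjTensor 𝕜 (finiteRank 𝕜 Y X) (finiteRank 𝕜 X Y)) :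
    ProjTensor 𝕜 (finiteRank 𝕜 Y X) (finiteRank 𝕜 X Y) :=
  projMap (postcomp W) (ContinuousLinearMap.id 𝕜 _) Δ

/-- The right action of operators on `X`, `(U ⊗ V) W = U ⊗ V W`. -/
def rightAct (Δ : ProjTensor 𝕜 (finiteRank 𝕜 Y X) (finiteRank 𝕜 X Y)) (W : X →L[𝕜] X) :
    ProjTensor 𝕜 (finiteRank 𝕜 Y X) (finiteRank 𝕜 X Y) :=
  projMap (ContinuousLinearMap.id 𝕜 _) (precomp W) Δ

/-- For finite-dimensional `X` and `Y` and a subalgebra `𝒜` of `F(X)` (here all operators on `X`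
have finite rank), `Δ` is a generalized diagonal for `𝒜` if `W Δ = Δ W` and `π(Δ) W = W` for all
`W` in `𝒜`. -/
def IsGeneralizedDiagonal [FiniteDimensional 𝕜 X] [FiniteDimensional 𝕜 Y]
    (𝒜 : NonUnitalSubalgebra 𝕜 (X →L[𝕜] X))
    (Δ : ProjTensor 𝕜 (finiteRank 𝕜 Y X) (finiteRank 𝕜 X Y)) : Prop :=
  haveI : CompleteSpace X := FiniteDimensional.complete 𝕜 X
  (∀ W ∈ 𝒜, leftAct W Δ = rightAct Δ W) ∧
    ∀ W ∈ 𝒜, (prodMap 𝕜 X Y Δ).comp W = W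

end Operators

end

end GenDiag

open scoped TensorProduct Topology
open Filter

/-! The projections form a bounded two-sided approximate identity of idempotents in `approximable 𝕜
X`: strong convergence of P_α gives P_α a → a, and strong convergence of the adjoints gives a P_α →
a, first for a of rank one and then by density. Limits are taken along an ultrafilter finer than the
net, so that bounded families of functionals converge weak-*.

Diagonals give amenability. Let D be a derivation into E*. A generalized diagonal Δ = ∑ U ⊗ V on the
range of P_α yields f_α = ∑ U · D(V), and these functionals are uniformly bounded. For w in P_α A(X)
P_α, the identities wΔ = Δw and π(Δ) = P_α together with the Leibniz rule give w · f_α - f_α · w =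
P_α · D(w) (`projLift_innerForm_commutator`). Since P_α a P_α → a, a weak-* limit φ of the f_α
implements the limit of P_α · D(a). This limit can differ from D(a), because E is not assumed
essential; `exists_inner_of_approx_inner` corrects φ.

Amenability gives diagonals. Let M₀ be a weak-* limit of P_α ⊗ P_α, acting on bilinear forms. Its
commutators form a derivation into the dual of the bilinear forms modulo the forms ψ(xy). Correcting
M₀ by an implementing functional produces a central M, a virtual diagonal
(`exists_virtual_diagonal`).

Now fix Y = X_α with f(u) = 1. The averaging operator Δ ↦ ∑ (bᵢ ⊗ f) Δ (u ⊗ bᵢ*) maps into the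
central tensors and preserves τ(Δ) = f(π(Δ)u). If every central tensor over X with τ = 1 had large
norm, Hahn–Banach would give a functional of small norm equal to τ on central tensors. Centrality of
M lets one average the corresponding bilinear form, which turns it into a form ψ(xy) at which M
equals 1, contradicting the bound on M (`CentralFunctional.exists_mem`). The resulting central
tensor involves all of X. Truncating its middle space to some X_β keeps it central and changes τ
little, and rescaling restores τ = 1. For a central tensor π(Δ) is τ(Δ) times the identity, so this
is a generalized diagonal. -/

namespace GenDiag

noncomputable section

set_option maxSynthPendingDepth 3

universe u v

/-! ### Pointwise and weak-* limits, and bilinear maps on quotients -/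

section Limits

variable {𝕜 : Type*} [RCLike 𝕜] {V W : Type*} [NormedAddCommGroup V] [NormedSpace 𝕜 V]
  [NormedAddCommGroup W] [NormedSpace 𝕜 W] {ι : Type*}

/-- A uniformly bounded family of operators that converges pointwise on a set converges pointwise
on its closure. -/
theorem tendsto_apply_of_mem_closure {V : Type*} [SeminormedAddCommGroup V] [NormedSpace 𝕜 V]
    {l : Filter ι} {L : ι → V →L[𝕜] W} {L₀ : V →L[𝕜] W}
    {C : ℝ} (hC : ∀ i, ‖L i‖ ≤ C) {s : Set V}
    (hs : ∀ v ∈ s, Tendsto (fun i => L i v) l (𝓝 (L₀ v))) {v : V} (hv : v ∈ closure s) :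
    Tendsto (fun i => L i v) l (𝓝 (L₀ v)) := by
  rcases isEmpty_or_nonempty ι with hι | ⟨⟨i₀⟩⟩
  · rw [l.filter_eq_bot_of_isEmpty]
    exact tendsto_bot
  have hC0 : 0 ≤ C := (norm_nonneg _).trans (hC i₀)
  rw [Metric.tendsto_nhds]
  intro ε hε
  have hd : 0 < C + ‖L₀‖ + 1 := by positivity
  obtain ⟨w, hw, hvw⟩ := Metric.mem_closure_iff.1 hv (ε / 2 / (C + ‖L₀‖ + 1)) (by positivity)
  rw [dist_eq_norm, lt_div_iff₀ hd] at hvw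
  filter_upwards [Metric.tendsto_nhds.1 (hs w hw) (ε / 2) (by positivity)] with i hi
  rw [dist_eq_norm] at hi ⊢
  have h1 : L i v - L₀ v = L i (v - w) + (L i w - L₀ w) - L₀ (v - w) := by
    simp only [map_sub]; abel
  have h2 : ‖L i (v - w)‖ ≤ C * ‖v - w‖ := (L i).le_of_opNorm_le (hC i) _
  have h3 : ‖L₀ (v - w)‖ ≤ ‖L₀‖ * ‖v - w‖ := L₀.le_opNorm _
  rw [h1]
  have h4 := norm_sub_le (L i (v - w) + (L i w - L₀ w)) (L₀ (v - w))
  have h5 := norm_add_le (L i (v - w)) (L i w - L₀ w)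
  nlinarith [norm_nonneg (v - w)]

/-- A bounded family of functionals has a weak-* limit along every ultrafilter. -/
theorem exists_weakStar_limit (U : Ultrafilter ι) (f : ι → StrongDual 𝕜 V) {C : ℝ}
    (hC : ∀ i, ‖f i‖ ≤ C) :
    ∃ g : StrongDual 𝕜 V, ∀ x, Tendsto (fun i => f i x) U (𝓝 (g x)) := by
  have hK := WeakDual.isCompact_closedBall (0 : StrongDual 𝕜 V) C
  obtain ⟨g, -, hg⟩ := hK.ultrafilter_le_nhds
    (U.map fun i => StrongDual.toWeakDual (f i)) (by
      rw [le_principal_iff]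
      refine mem_map.2 (Eventually.of_forall fun i => ?_)
      simpa using hC i)
  refine ⟨WeakDual.toStrongDual g, fun x => ?_⟩
  exact ((WeakDual.eval_continuous x).tendsto g).comp hg

/-- A bounded bilinear map that vanishes on a subspace in the second variable factors through the
quotient. -/
def quotientLift {A : Type*} [NormedAddCommGroup A] [NormedSpace 𝕜 A] (N : Submodule 𝕜 V)
    [IsClosed (N : Set V)] (T : A →L[𝕜] V →L[𝕜] W) (h : ∀ a, ∀ v ∈ N, T a v = 0) :
    A →L[𝕜] (V ⧸ N) →L[𝕜] W :=
  LinearMap.mkContinuous₂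
    (LinearMap.mk₂ 𝕜 (fun a q => N.liftQ (T a).toLinearMap (fun v hv => h a v hv) q)
      (by rintro a b ⟨v⟩; exact congrArg (fun S => S v) (T.map_add a b))
      (by rintro c a ⟨v⟩; exact congrArg (fun S => S v) (T.map_smul c a))
      (fun a q r => map_add _ q r) (fun c a q => map_smul _ c q)) ‖T‖ (by
    intro a q
    -- The quotient norm is an infimum, so a class has only almost norm-preserving representatives.
    refine le_of_forall_pos_le_add fun ε hε => ?_
    obtain ⟨v, rfl, hv⟩ := Submodule.Quotient.norm_mk_lt (S := N) q
      (ε := ε / (‖T‖ * ‖a‖ + 1)) (by positivity)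
    have h1 : ‖T a v‖ ≤ ‖T‖ * ‖a‖ * ‖v‖ := T.le_opNorm₂ a v
    have h2 : ‖T‖ * ‖a‖ * ‖v‖ ≤ ‖T‖ * ‖a‖ *
        (‖(Submodule.Quotient.mk v : V ⧸ N)‖ + ε / (‖T‖ * ‖a‖ + 1)) := by gcongr
    have h3 : ‖T‖ * ‖a‖ * (ε / (‖T‖ * ‖a‖ + 1)) ≤ ε := by
      rw [mul_div_assoc', div_le_iff₀ (by positivity)]
      nlinarith
    change ‖T a v‖ ≤ _
    linarith)

end Limits

/-! ### Inner derivations as limits, and virtual diagonals -/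

section Amenability

variable {𝕜 : Type v} [RCLike 𝕜] {A : Type u} [NonUnitalNormedRing A] [NormedSpace 𝕜 A]
  {ι : Type*}

/-- A derivation into a dual module is inner if it is approximately inner, in a bounded manner, up
to the left action of a bounded approximate identity. -/
theorem exists_inner_of_approx_inner (U : Ultrafilter ι) {e : ι → A} {C : ℝ} (hC : ∀ i, ‖e i‖ ≤ C)
    (hl : ∀ a, Tendsto (fun i => e i * a) U (𝓝 a)) (hr : ∀ a, Tendsto (fun i => a * e i) U (𝓝 a))
    {E : Type*} [NormedAddCommGroup E] [NormedSpace 𝕜 E] (M : BanachBimodule 𝕜 A E)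
    (D : A →L[𝕜] StrongDual 𝕜 E)
    (hD : ∀ a b : A, D (a * b) = M.dualRight (D a) b + M.dualLeft a (D b))
    (f : ι → StrongDual 𝕜 E) {K : ℝ} (hK : ∀ i, ‖f i‖ ≤ K)
    (hf : ∀ a x, Tendsto (fun i => f i (M.right a x) - f i (M.left a x) - D a (M.right (e i) x)) U
      (𝓝 0)) :
    ∃ g : StrongDual 𝕜 E, ∀ a : A, D a = M.dualLeft a g - M.dualRight g a := by
  obtain ⟨i₀⟩ : Nonempty ι := U.neBot.nonempty
  have hC0 : 0 ≤ C := (norm_nonneg _).trans (hC i₀)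
  obtain ⟨φ, hφ⟩ := exists_weakStar_limit U f hK
  obtain ⟨h, hh⟩ := exists_weakStar_limit U (fun i => D (e i)) (C := ‖D‖ * C)
    fun i => D.le_opNorm_of_le (hC i)
  obtain ⟨q, hq⟩ := exists_weakStar_limit U (fun i => h.comp (M.right (e i)))
    (C := ‖h‖ * (‖M.right‖ * C)) fun i => (h.opNorm_comp_le _).trans (by
      gcongr; exact M.right.le_opNorm_of_le (hC i))
  -- The left side is e i · D a, so its weak-* limit is a · φ - φ · a.
  have hQ : ∀ a x, Tendsto (fun i => D a (M.right (e i) x)) U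
      (𝓝 (φ (M.right a x) - φ (M.left a x))) := fun a x => by
    simpa using ((hφ (M.right a x)).sub (hφ (M.left a x))).sub (hf a x)
  have hright : ∀ a x, Tendsto (fun i => M.right (a * e i) x) U (𝓝 (M.right a x)) := fun a x =>
    ((M.right.flip x).continuous.tendsto a).comp (hr a)
  -- Limit of the Leibniz rule D(e i * a) = D(e i) · a + e i · D(a): this gives D a = h · a + (a · φ
  -- - φ · a).
  have hha : ∀ a x, h (M.left a x) + (φ (M.right a x) - φ (M.left a x)) = D a x := fun a x => by
    refine tendsto_nhds_unique ((hh (M.left a x)).add (hQ a x)) ?_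
    have h1 : Tendsto (fun i => D (e i * a) x) U (𝓝 (D a x)) :=
      ((D.flip x).continuous.tendsto a).comp (hl a)
    simpa [hD, BanachBimodule.dualLeft, BanachBimodule.dualRight] using h1
  have hqr : ∀ a x, q (M.right a x) = h (M.right a x) := fun a x => by
    refine tendsto_nhds_unique (hq (M.right a x)) ?_
    simpa [M.right_mul, Function.comp_def] using (h.continuous.tendsto _).comp (hright a x)
  -- At points x · e i the limit of e j · D(a) is D(a) itself, so the error term h · a vanishes
  -- there.
  have hzero : ∀ a x i, h (M.left a (M.right (e i) x)) = 0 := fun a x i => by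
    have h1 : Tendsto (fun j => D a (M.right (e j) (M.right (e i) x))) U
        (𝓝 (D a (M.right (e i) x))) := by
      simpa [M.right_mul, Function.comp_def] using ((D a).continuous.tendsto _).comp (hright (e i) x)
    have h2 := tendsto_nhds_unique (hQ a (M.right (e i) x)) h1
    have h3 := hha a (M.right (e i) x)
    rw [h2] at h3
    simpa using h3
  have hql : ∀ a x, q (M.left a x) = 0 := fun a x => by
    refine tendsto_nhds_unique (hq (M.left a x)) ?_
    simp [← M.left_right, hzero]
  -- Here a · q = a · h and q · a = 0. Hence h - q is killed by the left action while (h - q) · a =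
  -- h · a, so subtracting it from φ supplies exactly the missing term.
  refine ⟨φ - (h - q), fun a => ?_⟩
  ext x
  have h1 := hha a x
  simp only [BanachBimodule.dualLeft, BanachBimodule.dualRight, sub_apply,
    ContinuousLinearMap.comp_apply, hqr, hql]
  rw [← h1]
  ring

variable [IsScalarTower 𝕜 A A] [SMulCommClass 𝕜 A A]

/-- The right action `(B · a)(x, y) = B (a x, y)` on bilinear forms. -/
def bilinRight (𝕜 : Type v) [RCLike 𝕜] (A : Type u) [NonUnitalNormedRing A] [NormedSpace 𝕜 A]
    [IsScalarTower 𝕜 A A] [SMulCommClass 𝕜 A A] :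
    A →L[𝕜] (A →L[𝕜] A →L[𝕜] 𝕜) →L[𝕜] A →L[𝕜] A →L[𝕜] 𝕜 :=
  (ContinuousLinearMap.compL 𝕜 A A (A →L[𝕜] 𝕜)).flip.comp (ContinuousLinearMap.mul 𝕜 A)

/-- The left action `(a · B)(x, y) = B (x, y a)` on bilinear forms. -/
def bilinLeft (𝕜 : Type v) [RCLike 𝕜] (A : Type u) [NonUnitalNormedRing A] [NormedSpace 𝕜 A]
    [IsScalarTower 𝕜 A A] [SMulCommClass 𝕜 A A] :
    A →L[𝕜] (A →L[𝕜] A →L[𝕜] 𝕜) →L[𝕜] A →L[𝕜] A →L[𝕜] 𝕜 :=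
  (ContinuousLinearMap.compL 𝕜 A (A →L[𝕜] 𝕜) (A →L[𝕜] 𝕜)).comp
    ((ContinuousLinearMap.compL 𝕜 A A 𝕜).flip.comp (ContinuousLinearMap.mul 𝕜 A).flip)

@[simp] theorem bilinRight_apply (a x y : A) (B : A →L[𝕜] A →L[𝕜] 𝕜) :
    bilinRight 𝕜 A a B x y = B (a * x) y := rfl

@[simp] theorem bilinLeft_apply (a x y : A) (B : A →L[𝕜] A →L[𝕜] 𝕜) :
    bilinLeft 𝕜 A a B x y = B x (y * a) := rfl

/-- The bilinear form `(x, y) ↦ ψ (x y)`. -/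
def mulForm (𝕜 : Type v) [RCLike 𝕜] (A : Type u) [NonUnitalNormedRing A] [NormedSpace 𝕜 A]
    [IsScalarTower 𝕜 A A] [SMulCommClass 𝕜 A A] :
    StrongDual 𝕜 A →L[𝕜] A →L[𝕜] A →L[𝕜] 𝕜 :=
  ((ContinuousLinearMap.compL 𝕜 A (A →L[𝕜] A) (A →L[𝕜] 𝕜)).flip (ContinuousLinearMap.mul 𝕜 A)).comp
    (ContinuousLinearMap.compL 𝕜 A A 𝕜)

@[simp] theorem mulForm_apply (ψ : StrongDual 𝕜 A) (x y : A) :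
    mulForm 𝕜 A ψ x y = ψ (x * y) := rfl

/-- The closed subspace of bilinear forms spanned by the forms `(x, y) ↦ ψ (x y)`. -/
def mulForms (𝕜 : Type v) [RCLike 𝕜] (A : Type u) [NonUnitalNormedRing A] [NormedSpace 𝕜 A]
    [IsScalarTower 𝕜 A A] [SMulCommClass 𝕜 A A] : Submodule 𝕜 (A →L[𝕜] A →L[𝕜] 𝕜) :=
  (LinearMap.range (mulForm 𝕜 A).toLinearMap).topologicalClosure

instance : IsClosed (mulForms 𝕜 A : Set (A →L[𝕜] A →L[𝕜] 𝕜)) :=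
  Submodule.isClosed_topologicalClosure _

theorem mulForm_mem (ψ : StrongDual 𝕜 A) : mulForm 𝕜 A ψ ∈ mulForms 𝕜 A :=
  Submodule.le_topologicalClosure _ ⟨ψ, rfl⟩

theorem mem_of_mulForm_mem {N : Submodule 𝕜 (A →L[𝕜] A →L[𝕜] 𝕜)}
    (hN : IsClosed (N : Set (A →L[𝕜] A →L[𝕜] 𝕜)))
    (h : ∀ ψ, mulForm 𝕜 A ψ ∈ N) : mulForms 𝕜 A ≤ N :=
  Submodule.topologicalClosure_minimal _ (by rintro _ ⟨ψ, rfl⟩; exact h ψ) hN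

theorem bilinRight_mem (a : A) : ∀ B ∈ mulForms 𝕜 A, bilinRight 𝕜 A a B ∈ mulForms 𝕜 A := by
  refine mem_of_mulForm_mem
    (N := (mulForms 𝕜 A).comap (bilinRight 𝕜 A a).toLinearMap) ?_ fun ψ => ?_
  · exact IsClosed.preimage (bilinRight 𝕜 A a).continuous
      (inferInstance : IsClosed (mulForms 𝕜 A : Set (A →L[𝕜] A →L[𝕜] 𝕜)))
  · have h : bilinRight 𝕜 A a (mulForm 𝕜 A ψ) =
        mulForm 𝕜 A (ψ.comp (ContinuousLinearMap.mul 𝕜 A a)) := by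
      ext x y
      simp [mul_assoc]
    exact Submodule.mem_comap.2 (h ▸ mulForm_mem _)

theorem bilinLeft_mem (a : A) : ∀ B ∈ mulForms 𝕜 A, bilinLeft 𝕜 A a B ∈ mulForms 𝕜 A := by
  refine mem_of_mulForm_mem
    (N := (mulForms 𝕜 A).comap (bilinLeft 𝕜 A a).toLinearMap) ?_ fun ψ => ?_
  · exact IsClosed.preimage (bilinLeft 𝕜 A a).continuous
      (inferInstance : IsClosed (mulForms 𝕜 A : Set (A →L[𝕜] A →L[𝕜] 𝕜)))
  · have h : bilinLeft 𝕜 A a (mulForm 𝕜 A ψ) =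
        mulForm 𝕜 A (ψ.comp ((ContinuousLinearMap.mul 𝕜 A).flip a)) := by
      ext x y
      simp [mul_assoc]
    exact Submodule.mem_comap.2 (h ▸ mulForm_mem _)

theorem bilinLeft_mul (a b : A) (B : A →L[𝕜] A →L[𝕜] 𝕜) :
    bilinLeft 𝕜 A (a * b) B = bilinLeft 𝕜 A a (bilinLeft 𝕜 A b B) := by
  ext x y
  simp [mul_assoc]

theorem bilinRight_mul (a b : A) (B : A →L[𝕜] A →L[𝕜] 𝕜) :
    bilinRight 𝕜 A (a * b) B = bilinRight 𝕜 A b (bilinRight 𝕜 A a B) := by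
  ext x y
  simp [mul_assoc]

theorem bilinLeft_bilinRight (a b : A) (B : A →L[𝕜] A →L[𝕜] 𝕜) :
    bilinLeft 𝕜 A a (bilinRight 𝕜 A b B) = bilinRight 𝕜 A b (bilinLeft 𝕜 A a B) := rfl

/-- The bimodule of bilinear forms modulo the forms `(x, y) ↦ ψ (x y)`. -/
def quotientBimodule (𝕜 : Type v) [RCLike 𝕜] (A : Type u) [NonUnitalNormedRing A]
    [NormedSpace 𝕜 A] [IsScalarTower 𝕜 A A] [SMulCommClass 𝕜 A A] :
    BanachBimodule 𝕜 A ((A →L[𝕜] A →L[𝕜] 𝕜) ⧸ mulForms 𝕜 A) where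
  left := quotientLift (mulForms 𝕜 A)
    ((ContinuousLinearMap.compL 𝕜 _ _ _ (mulForms 𝕜 A).mkQL).comp (bilinLeft 𝕜 A))
    fun a v hv => (Submodule.Quotient.mk_eq_zero _).2 (bilinLeft_mem a v hv)
  right := quotientLift (mulForms 𝕜 A)
    ((ContinuousLinearMap.compL 𝕜 _ _ _ (mulForms 𝕜 A).mkQL).comp (bilinRight 𝕜 A))
    fun a v hv => (Submodule.Quotient.mk_eq_zero _).2 (bilinRight_mem a v hv)
  left_mul := by
    rintro a b ⟨B⟩
    exact congrArg (mulForms 𝕜 A).mkQL (bilinLeft_mul a b B)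
  right_mul := by
    rintro a b ⟨B⟩
    exact congrArg (mulForms 𝕜 A).mkQL (bilinRight_mul a b B)
  left_right := by
    rintro a b ⟨B⟩
    rfl

/-- The commutator `a ↦ a · M - M · a` of a functional on bilinear forms. -/
def commutator (M : StrongDual 𝕜 (A →L[𝕜] A →L[𝕜] 𝕜)) :
    A →L[𝕜] (A →L[𝕜] A →L[𝕜] 𝕜) →L[𝕜] 𝕜 :=
  (ContinuousLinearMap.compL 𝕜 _ _ _ M).comp (bilinRight 𝕜 A - bilinLeft 𝕜 A)

theorem commutator_apply (M : StrongDual 𝕜 (A →L[𝕜] A →L[𝕜] 𝕜)) (a : A)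
    (B : A →L[𝕜] A →L[𝕜] 𝕜) :
    commutator M a B = M (bilinRight 𝕜 A a B) - M (bilinLeft 𝕜 A a B) :=
  map_sub M _ _

/-- This is the Leibniz rule for a ↦ a · M - M · a, evaluated at a form. -/
theorem commutator_mul (M : StrongDual 𝕜 (A →L[𝕜] A →L[𝕜] 𝕜)) (a b : A)
    (B : A →L[𝕜] A →L[𝕜] 𝕜) :
    commutator M (a * b) B =
      commutator M a (bilinLeft 𝕜 A b B) + commutator M b (bilinRight 𝕜 A a B) := by
  rw [commutator_apply, commutator_apply, commutator_apply, bilinRight_mul, bilinLeft_mul,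
    bilinLeft_bilinRight]
  ring

/-- In an amenable algebra, a functional on bilinear forms whose commutators vanish on the forms
`(x, y) ↦ ψ (x y)` can be made central without changing its values at these forms. -/
theorem exists_central_of_commutator_eq_zero (hA : IsAmenable 𝕜 A)
    (M₀ : StrongDual 𝕜 (A →L[𝕜] A →L[𝕜] 𝕜))
    (hM : ∀ a ψ, commutator M₀ a (mulForm 𝕜 A ψ) = 0) :
    ∃ M : StrongDual 𝕜 (A →L[𝕜] A →L[𝕜] 𝕜),
      (∀ a B, M (bilinRight 𝕜 A a B) = M (bilinLeft 𝕜 A a B)) ∧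
      ∀ ψ : StrongDual 𝕜 A, M (mulForm 𝕜 A ψ) = M₀ (mulForm 𝕜 A ψ) := by
  have hT : ∀ a, ∀ B ∈ mulForms 𝕜 A, commutator M₀ a B = 0 := fun a =>
    mem_of_mulForm_mem (N := LinearMap.ker (commutator M₀ a).toLinearMap)
      (commutator M₀ a).isClosed_ker (hM a)
  -- The commutators vanish on `mulForms`, so they descend to a derivation into the dual of the
  -- quotient, and there amenability applies.
  obtain ⟨f, hf⟩ := hA _ (quotientBimodule 𝕜 A)
    (quotientLift (mulForms 𝕜 A) (commutator M₀) hT) (by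
      intro a b
      refine ContinuousLinearMap.ext fun q => ?_
      obtain ⟨B, rfl⟩ := Submodule.mkQ_surjective _ q
      exact commutator_mul M₀ a b B)
  -- The correction factors through the quotient; it cancels the commutators and leaves the values
  -- on `mulForms` unchanged.
  refine ⟨M₀ - f.comp (mulForms 𝕜 A).mkQL, fun a B => ?_, fun ψ => ?_⟩
  · have h1 : commutator M₀ a B = f ((mulForms 𝕜 A).mkQL (bilinRight 𝕜 A a B))
        - f ((mulForms 𝕜 A).mkQL (bilinLeft 𝕜 A a B)) :=
      congrArg (fun g => g ((mulForms 𝕜 A).mkQL B)) (hf a)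
    rw [commutator_apply] at h1
    change M₀ _ - f _ = M₀ _ - f _
    linear_combination h1
  · have h1 : (mulForms 𝕜 A).mkQL (mulForm 𝕜 A ψ) = 0 :=
      (Submodule.Quotient.mk_eq_zero _).2 (mulForm_mem ψ)
    change M₀ _ - f ((mulForms 𝕜 A).mkQL (mulForm 𝕜 A ψ)) = M₀ _
    rw [h1, map_zero, sub_zero]

/-- An amenable Banach algebra with a bounded approximate identity of idempotents has a virtual
diagonal. -/
theorem exists_virtual_diagonal (hA : IsAmenable 𝕜 A) (U : Ultrafilter ι) {e : ι → A} {C : ℝ}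
    (hC : ∀ i, ‖e i‖ ≤ C) (he : ∀ i, IsIdempotentElem (e i))
    (hl : ∀ a, Tendsto (fun i => e i * a) U (𝓝 a))
    (hr : ∀ a, Tendsto (fun i => a * e i) U (𝓝 a)) :
    ∃ M : StrongDual 𝕜 (A →L[𝕜] A →L[𝕜] 𝕜),
      (∀ a B, M (bilinRight 𝕜 A a B) = M (bilinLeft 𝕜 A a B)) ∧
      ∀ ψ : StrongDual 𝕜 A, Tendsto (fun i => ψ (e i)) U (𝓝 (M (mulForm 𝕜 A ψ))) := by
  obtain ⟨i₀⟩ : Nonempty ι := U.neBot.nonempty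
  have hC0 : 0 ≤ C := (norm_nonneg _).trans (hC i₀)
  -- M₀ is a weak-* limit of e i ⊗ e i. Idempotence makes its value at the form ψ(xy) the limit of
  -- ψ(e i).
  obtain ⟨M₀, hM₀⟩ := exists_weakStar_limit (V := A →L[𝕜] A →L[𝕜] 𝕜) U
    (fun i => (ContinuousLinearMap.apply 𝕜 𝕜 (e i)).comp
      (ContinuousLinearMap.apply 𝕜 (A →L[𝕜] 𝕜) (e i))) (C := C * C) (fun i => by
      refine ContinuousLinearMap.opNorm_le_bound _ (by positivity) fun B => ?_
      refine (B.le_opNorm₂ (e i) (e i)).trans ?_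
      have := hC i
      have h1 : ‖B‖ * ‖e i‖ * ‖e i‖ ≤ ‖B‖ * C * C := by gcongr
      linarith)
  replace hM₀ : ∀ B, Tendsto (fun i => B (e i) (e i)) U (𝓝 (M₀ B)) := hM₀
  have hψ : ∀ ψ, Tendsto (fun i => ψ (e i)) U (𝓝 (M₀ (mulForm 𝕜 A ψ))) := fun ψ => by
    simpa [(he _).eq] using hM₀ (mulForm 𝕜 A ψ)
  obtain ⟨M, hM, hM'⟩ := exists_central_of_commutator_eq_zero hA M₀ fun a ψ => by
    rw [commutator_apply, sub_eq_zero]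
    have h1 : Tendsto (fun i => ψ (a * e i)) U (𝓝 (M₀ (bilinRight 𝕜 A a (mulForm 𝕜 A ψ)))) := by
      simpa [mul_assoc, (he _).eq] using hM₀ (bilinRight 𝕜 A a (mulForm 𝕜 A ψ))
    have h2 : Tendsto (fun i => ψ (e i * a)) U (𝓝 (M₀ (bilinLeft 𝕜 A a (mulForm 𝕜 A ψ)))) := by
      simpa [← mul_assoc, (he _).eq] using hM₀ (bilinLeft 𝕜 A a (mulForm 𝕜 A ψ))
    rw [tendsto_nhds_unique h1 ((ψ.continuous.tendsto a).comp (hr a)),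
      tendsto_nhds_unique h2 ((ψ.continuous.tendsto a).comp (hl a))]
  exact ⟨M, hM, fun ψ => by rw [hM']; exact hψ ψ⟩

end Amenability

/-! ### Density of elementary tensors and norm bounds in the projective tensor product -/

section Projective

variable {𝕜 : Type*} [RCLike 𝕜] {E F E' F' G : Type*} [NormedAddCommGroup E] [NormedSpace 𝕜 E]
  [NormedAddCommGroup F] [NormedSpace 𝕜 F] [NormedAddCommGroup E'] [NormedSpace 𝕜 E']
  [NormedAddCommGroup F'] [NormedSpace 𝕜 F'] [NormedAddCommGroup G] [NormedSpace 𝕜 G]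

variable (𝕜 E F) in
/-- The span of the elementary tensors in the projective tensor product. -/
def ptmulSpan : Submodule 𝕜 (ProjTensor 𝕜 E F) :=
  Submodule.span 𝕜 {s : ProjTensor 𝕜 E F | ∃ x y, s = ptmul 𝕜 x y}

theorem mem_closure_ptmulSpan (t : ProjTensor 𝕜 E F) :
    t ∈ closure (ptmulSpan 𝕜 E F : Set (ProjTensor 𝕜 E F)) := by
  refine closure_mono ?_ (UniformSpace.Completion.denseRange_coe t)
  rintro _ ⟨s, rfl⟩
  obtain ⟨s, rfl⟩ := (toAlg 𝕜 E F).surjective s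
  induction s using TensorProduct.induction_on with
  | zero =>
    rw [map_zero, UniformSpace.Completion.coe_zero]
    exact Submodule.zero_mem _
  | tmul x y => exact Submodule.subset_span ⟨x, y, rfl⟩
  | add s t hs ht =>
    rw [map_add, UniformSpace.Completion.coe_add]
    exact Submodule.add_mem _ hs ht

/-- Bounded operators on a projective tensor product that agree on elementary tensors are equal. -/
theorem projTensor_ext {S T : ProjTensor 𝕜 E F →L[𝕜] G}
    (h : ∀ x y, S (ptmul 𝕜 x y) = T (ptmul 𝕜 x y)) : S = T := by
  ext t
  refine Set.EqOn.closure (s := ptmulSpan 𝕜 E F) ?_ S.continuous T.continuous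
    (mem_closure_ptmulSpan t)
  refine LinearMap.eqOn_span (f := S.toLinearMap) (g := T.toLinearMap) ?_
  rintro _ ⟨x, y, rfl⟩
  exact h x y

theorem norm_projLift_apply_le [CompleteSpace G] (B : E →L[𝕜] F →L[𝕜] G) (t : ProjTensor 𝕜 E F) :
    ‖projLift B t‖ ≤ ‖B‖ * ‖t‖ := by
  induction t using UniformSpace.Completion.induction_on with
  | hp => exact isClosed_le (by fun_prop) (by fun_prop)
  | ih t =>
    rw [projLift_coe, UniformSpace.Completion.norm_coe]
    exact (algLift B).le_of_opNorm_le (LinearMap.mkContinuous_norm_le _ (norm_nonneg B) _) t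

theorem norm_ptmul_le (x : E) (y : F) : ‖ptmul 𝕜 x y‖ ≤ ‖x‖ * ‖y‖ := by
  rw [ptmul, UniformSpace.Completion.norm_coe, norm_eq_projNorm]
  simpa [tensorSum, tensorCost] using projNorm_le 𝕜 [(x, y)]

theorem norm_projMap_apply_le (S : E →L[𝕜] E') (T : F →L[𝕜] F') (t : ProjTensor 𝕜 E F) :
    ‖projMap S T t‖ ≤ ‖S‖ * ‖T‖ * ‖t‖ := by
  refine (norm_projLift_apply_le _ t).trans ?_
  gcongr
  refine ContinuousLinearMap.opNorm_le_bound₂ _ (by positivity) fun x y => ?_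
  rw [ContinuousLinearMap.bilinearComp_apply, ptmulL_apply]
  calc ‖ptmul 𝕜 (S x) (T y)‖ ≤ ‖S x‖ * ‖T y‖ := norm_ptmul_le _ _
    _ ≤ (‖S‖ * ‖x‖) * (‖T‖ * ‖y‖) := by gcongr <;> exact ContinuousLinearMap.le_opNorm _ _
    _ = ‖S‖ * ‖T‖ * ‖x‖ * ‖y‖ := by ring

end Projective

/-! ### Approximate identities in A(X), and operators to and from ranges of projections -/

section Operators

variable {𝕜 : Type*} [RCLike 𝕜] {X Y Z : Type*} [NormedAddCommGroup X] [NormedSpace 𝕜 X]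
  [NormedAddCommGroup Y] [NormedSpace 𝕜 Y] [NormedAddCommGroup Z] [NormedSpace 𝕜 Z]

theorem mem_finiteRank_of_dom [FiniteDimensional 𝕜 X] (T : X →L[𝕜] Y) : T ∈ finiteRank 𝕜 X Y := by
  change FiniteDimensional 𝕜 (LinearMap.range T.toLinearMap)
  infer_instance

theorem mem_finiteRank_of_codom [FiniteDimensional 𝕜 Y] (T : X →L[𝕜] Y) : T ∈ finiteRank 𝕜 X Y := by
  change FiniteDimensional 𝕜 (LinearMap.range T.toLinearMap)
  infer_instance

/-- A continuous finite-rank operator is a sum of operators of rank at most one. -/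
theorem mem_span_smulRight {T : X →L[𝕜] Y} (hT : T ∈ finiteRank 𝕜 X Y) :
    T ∈ Submodule.span 𝕜 {S : X →L[𝕜] Y | ∃ (f : StrongDual 𝕜 X) (y : Y), S = f.smulRight y} := by
  have : FiniteDimensional 𝕜 (LinearMap.range T.toLinearMap) := hT
  let R := LinearMap.range T.toLinearMap
  let b := Module.finBasis 𝕜 R
  let T' : X →L[𝕜] R := T.codRestrict R fun x => ⟨x, rfl⟩
  have h : T = ∑ i, ((LinearMap.toContinuousLinearMap (b.coord i)).comp T').smulRight
      (b i : Y) := by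
    ext x
    have h1 : T x = R.subtype (T' x) := rfl
    rw [h1, ← b.sum_repr (T' x), map_sum, sum_apply]
    rfl
  rw [h]
  exact Submodule.sum_mem _ fun i _ => Submodule.subset_span ⟨_, _, rfl⟩

theorem mem_approximable {T : X →L[𝕜] X} (hT : T ∈ finiteRank 𝕜 X X) : T ∈ approximable 𝕜 X :=
  subset_closure hT

variable {ι : Type*} {l : Filter ι}

/-- Bounded nets converging strongly to the identity converge to it uniformly on the ranges of
approximable operators. -/
theorem tendsto_comp_of_approximable {L : ι → X →L[𝕜] X} {C : ℝ} (hC : ∀ i, ‖L i‖ ≤ C)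
    (h : ∀ x, Tendsto (fun i => L i x) l (𝓝 x)) {T : X →L[𝕜] X} (hT : T ∈ approximable 𝕜 X) :
    Tendsto (fun i => (L i).comp T) l (𝓝 T) := by
  refine tendsto_apply_of_mem_closure (L := fun i => ContinuousLinearMap.compL 𝕜 X X X (L i))
    (L₀ := ContinuousLinearMap.id 𝕜 (X →L[𝕜] X)) (C := C) (s := finiteRankAlg 𝕜 X) (fun i => ?_)
    (fun S hS => ?_) hT
  · refine ContinuousLinearMap.opNorm_le_bound _ ((norm_nonneg _).trans (hC i)) fun S => ?_
    exact ((L i).opNorm_comp_le S).trans (by gcongr; exact hC i)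
  · replace hS := mem_span_smulRight (show S ∈ finiteRank 𝕜 X X from hS)
    induction hS using Submodule.span_induction with
    | zero => simpa using tendsto_const_nhds
    | mem S hS =>
      obtain ⟨f, y, rfl⟩ := hS
      have h1 : Tendsto (fun i => f.smulRight (L i y)) l (𝓝 (f.smulRight y)) :=
        ((ContinuousLinearMap.smulRightL 𝕜 X X f).continuous.tendsto y).comp (h y)
      refine h1.congr fun i => ?_
      ext x
      simp
    | add S T _ _ hS hT => simpa using hS.add hT
    | smul c S _ hS => simpa using hS.const_smul c

/-- Bounded nets whose adjoints converge strongly to the identity are right approximate identities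
for the approximable operators. -/
theorem tendsto_approximable_comp {L : ι → X →L[𝕜] X} {C : ℝ} (hC : ∀ i, ‖L i‖ ≤ C)
    (h : ∀ f : StrongDual 𝕜 X, Tendsto (fun i => f.comp (L i)) l (𝓝 f)) {T : X →L[𝕜] X}
    (hT : T ∈ approximable 𝕜 X) :
    Tendsto (fun i => T.comp (L i)) l (𝓝 T) := by
  refine tendsto_apply_of_mem_closure
    (L := fun i => (ContinuousLinearMap.compL 𝕜 X X X).flip (L i))
    (L₀ := ContinuousLinearMap.id 𝕜 (X →L[𝕜] X)) (C := C) (s := finiteRankAlg 𝕜 X) (fun i => ?_)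
    (fun S hS => ?_) hT
  · refine ContinuousLinearMap.opNorm_le_bound _ ((norm_nonneg _).trans (hC i)) fun S => ?_
    refine (S.opNorm_comp_le (L i)).trans ?_
    rw [mul_comm]
    gcongr
    exact hC i
  · replace hS := mem_span_smulRight (show S ∈ finiteRank 𝕜 X X from hS)
    induction hS using Submodule.span_induction with
    | zero => simpa using tendsto_const_nhds
    | mem S hS =>
      obtain ⟨f, y, rfl⟩ := hS
      have h1 : Tendsto (fun i => (f.comp (L i)).smulRight y) l (𝓝 (f.smulRight y)) :=
        ((((ContinuousLinearMap.smulRightL 𝕜 X X).flip y).continuous.tendsto f).comp (h f))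
      refine h1.congr fun i => ?_
      ext x
      simp
    | add S T _ _ hS hT => simpa using hS.add hT
    | smul c S _ hS => simpa using hS.const_smul c

/-- The map `U ↦ S U R` from the operators on a finite-dimensional space to `A(X)`. -/
def sandwich [FiniteDimensional 𝕜 Y] (S : Z →L[𝕜] X) (R : X →L[𝕜] Y) :
    (Y →L[𝕜] Z) →L[𝕜] approximable 𝕜 X :=
  LinearMap.mkContinuous
    { toFun := fun U => ⟨(S.comp U).comp R,
        mem_approximable (comp_mem_finiteRank_right (mem_finiteRank_of_dom _) R)⟩
      map_add' := fun U V => Subtype.ext (by ext x; simp)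
      map_smul' := fun c U => Subtype.ext (by ext x; simp) } (‖S‖ * ‖R‖) (by
    intro U
    change ‖(S.comp U).comp R‖ ≤ _
    calc ‖(S.comp U).comp R‖ ≤ ‖S.comp U‖ * ‖R‖ := ContinuousLinearMap.opNorm_comp_le _ _
      _ ≤ ‖S‖ * ‖U‖ * ‖R‖ := by gcongr; exact ContinuousLinearMap.opNorm_comp_le _ _
      _ = ‖S‖ * ‖R‖ * ‖U‖ := by ring)

theorem norm_sandwich_le [FiniteDimensional 𝕜 Y] (S : Z →L[𝕜] X) (R : X →L[𝕜] Y) :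
    ‖sandwich S R‖ ≤ ‖S‖ * ‖R‖ :=
  LinearMap.mkContinuous_norm_le _ (by positivity) _

namespace ApproxProj

/-- The inclusion of the range of a projection. -/
def incl (p : ApproxProj 𝕜 X) : p.rg →L[𝕜] X := p.rg.subtypeL

/-- A projection, regarded as an operator onto its range. -/
def proj (p : ApproxProj 𝕜 X) : X →L[𝕜] p.rg := p.op.codRestrict p.rg fun x => ⟨x, rfl⟩

@[simp] theorem proj_coe (p : ApproxProj 𝕜 X) (x : p.rg) : p.proj x = x :=
  Subtype.ext (p.op_apply_of_mem x.2)

@[simp] theorem op_coe (p : ApproxProj 𝕜 X) (x : p.rg) : p.op x = x := p.op_apply_of_mem x.2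

theorem norm_incl_le (p : ApproxProj 𝕜 X) : ‖p.incl‖ ≤ 1 := p.rg.norm_subtypeL_le

theorem norm_proj_le (p : ApproxProj 𝕜 X) : ‖p.proj‖ ≤ ‖p.op‖ :=
  ContinuousLinearMap.opNorm_le_bound _ (norm_nonneg _) fun x => p.op.le_opNorm x

end ApproxProj

theorem norm_postcomp_le (W : Y →L[𝕜] Z) : ‖postcomp (X := X) W‖ ≤ ‖W‖ :=
  ContinuousLinearMap.opNorm_le_bound _ (norm_nonneg _) fun T => W.opNorm_comp_le T.1

theorem norm_precomp_le (W : X →L[𝕜] Y) : ‖precomp (Z := Z) W‖ ≤ ‖W‖ :=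
  ContinuousLinearMap.opNorm_le_bound _ (norm_nonneg _) fun T => by
    rw [mul_comm]
    exact T.1.opNorm_comp_le W

theorem prodMap_ptmul [CompleteSpace X] (S : finiteRank 𝕜 Y X) (T : finiteRank 𝕜 X Y) :
    prodMap 𝕜 X Y (ptmul 𝕜 S T) = S.1.comp T.1 :=
  projLift_ptmul _ S T

theorem prodMap_leftAct [CompleteSpace X] (W : X →L[𝕜] X)
    (Δ : ProjTensor 𝕜 (finiteRank 𝕜 Y X) (finiteRank 𝕜 X Y)) :
    prodMap 𝕜 X Y (leftAct W Δ) = W.comp (prodMap 𝕜 X Y Δ) := by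
  have h : (prodMap 𝕜 X Y).comp (projMap (postcomp W) (ContinuousLinearMap.id 𝕜 _)) =
      (ContinuousLinearMap.compL 𝕜 X X X W).comp (prodMap 𝕜 X Y) := by
    refine projTensor_ext fun S T => ?_
    simp only [ContinuousLinearMap.comp_apply, projMap_ptmul, prodMap_ptmul]
    rfl
  exact congrArg (fun L => L Δ) h

theorem prodMap_rightAct [CompleteSpace X] (W : X →L[𝕜] X)
    (Δ : ProjTensor 𝕜 (finiteRank 𝕜 Y X) (finiteRank 𝕜 X Y)) :
    prodMap 𝕜 X Y (rightAct Δ W) = (prodMap 𝕜 X Y Δ).comp W := by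
  have h : (prodMap 𝕜 X Y).comp (projMap (ContinuousLinearMap.id 𝕜 _) (precomp W)) =
      ((ContinuousLinearMap.compL 𝕜 X X X).flip W).comp (prodMap 𝕜 X Y) := by
    refine projTensor_ext fun S T => ?_
    simp only [ContinuousLinearMap.comp_apply, projMap_ptmul, prodMap_ptmul]
    rfl
  exact congrArg (fun L => L Δ) h

end Operators

/-! ### The functional built from a derivation and a tensor -/

section InnerForm

variable {𝕜 : Type*} [RCLike 𝕜] {A : Type*} [NonUnitalNormedRing A] [NormedSpace 𝕜 A]
  {E F G : Type*} [NormedAddCommGroup E] [NormedSpace 𝕜 E] [NormedAddCommGroup F]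
  [NormedSpace 𝕜 F] [NormedAddCommGroup G] [NormedSpace 𝕜 G]

/-- The bilinear map `(U, V) ↦ σ(U) · D(ρ(V))`. -/
def innerForm (M : BanachBimodule 𝕜 A E) (D : A →L[𝕜] StrongDual 𝕜 E) (σ : F →L[𝕜] A)
    (ρ : G →L[𝕜] A) : F →L[𝕜] G →L[𝕜] StrongDual 𝕜 E :=
  (ContinuousLinearMap.compL 𝕜 E E 𝕜).flip.bilinearComp (M.right.comp σ) (D.comp ρ)

theorem innerForm_apply (M : BanachBimodule 𝕜 A E) (D : A →L[𝕜] StrongDual 𝕜 E) (σ : F →L[𝕜] A)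
    (ρ : G →L[𝕜] A) (U : F) (V : G) (x : E) :
    innerForm M D σ ρ U V x = D (ρ V) (M.right (σ U) x) := rfl

theorem norm_innerForm_le (M : BanachBimodule 𝕜 A E) (D : A →L[𝕜] StrongDual 𝕜 E) {σ : F →L[𝕜] A}
    {ρ : G →L[𝕜] A} {C : ℝ} (hσ : ‖σ‖ ≤ C) (hρ : ‖ρ‖ ≤ C) :
    ‖innerForm M D σ ρ‖ ≤ ‖D‖ * C * (‖M.right‖ * C) := by
  have hC : 0 ≤ C := (norm_nonneg _).trans hσ
  refine ContinuousLinearMap.opNorm_le_bound₂ _ (by positivity) fun U V => ?_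
  calc ‖innerForm M D σ ρ U V‖ ≤ ‖D (ρ V)‖ * ‖M.right (σ U)‖ :=
        ContinuousLinearMap.opNorm_comp_le _ _
    _ ≤ (‖D‖ * (C * ‖V‖)) * (‖M.right‖ * (C * ‖U‖)) := by
        gcongr
        · exact D.le_opNorm_of_le (ρ.le_of_opNorm_le hρ V)
        · exact M.right.le_opNorm_of_le (σ.le_of_opNorm_le hσ U)
    _ = ‖D‖ * C * (‖M.right‖ * C) * ‖U‖ * ‖V‖ := by ring

/-- The commutator of an element `w` with the functional obtained from a derivation and a tensor
commuting with `w`. -/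
theorem projLift_innerForm_commutator (M : BanachBimodule 𝕜 A E) (D : A →L[𝕜] StrongDual 𝕜 E)
    (hD : ∀ a b, D (a * b) = M.dualRight (D a) b + M.dualLeft a (D b)) (σ : F →L[𝕜] A)
    (ρ : G →L[𝕜] A) {w : A} {L : F →L[𝕜] F} {R : G →L[𝕜] G} (hL : ∀ U, σ (L U) = w * σ U)
    (hR : ∀ V, ρ (R V) = ρ V * w) {m : ProjTensor 𝕜 F G →L[𝕜] A}
    (hm : ∀ U V, m (ptmul 𝕜 U V) = σ U * ρ V) {Δ : ProjTensor 𝕜 F G} {a : A}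
    (ha : m Δ = a) (x : E)
    (hΔ : projMap L (ContinuousLinearMap.id 𝕜 _) Δ = projMap (ContinuousLinearMap.id 𝕜 _) R Δ) :
    projLift (innerForm M D σ ρ) Δ (M.right w x) - projLift (innerForm M D σ ρ) Δ (M.left w x) =
      D w (M.right a x) := by
  subst ha
  -- On U ⊗ V, expanding D(V w) = D(V) · w + V · D(w) shows that the commutator with w equals the
  -- effect of wΔ - Δw plus UV · D(w). The first term vanishes at Δ.
  have h : (ContinuousLinearMap.apply 𝕜 𝕜 (M.right w x) -
        ContinuousLinearMap.apply 𝕜 𝕜 (M.left w x)).comp (projLift (innerForm M D σ ρ)) =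
      (ContinuousLinearMap.apply 𝕜 𝕜 x).comp
        ((projLift (innerForm M D σ ρ)).comp (projMap L (ContinuousLinearMap.id 𝕜 _)) -
          (projLift (innerForm M D σ ρ)).comp (projMap (ContinuousLinearMap.id 𝕜 _) R)) +
      ((D w).comp (M.right.flip x)).comp m := by
    refine projTensor_ext fun U V => ?_
    simp only [ContinuousLinearMap.comp_apply, sub_apply, add_apply,
      ContinuousLinearMap.apply_apply, projMap_ptmul, projLift_ptmul, hm, hL, hR,
      innerForm_apply, ContinuousLinearMap.id_apply, ContinuousLinearMap.flip_apply,
      M.right_mul, hD, BanachBimodule.dualLeft, BanachBimodule.dualRight, M.left_right]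
    ring
  have h1 := congrArg (fun L => L Δ) h
  simp only [ContinuousLinearMap.comp_apply, sub_apply, add_apply, hΔ, sub_self, map_zero,
    zero_add] at h1
  exact h1

/-- A derivation into a dual module is inner if, in a bounded manner and up to the left action of
a bounded approximate identity `e`, it is inner on each `e i * a * e i`. -/
theorem exists_inner_of_inner_on_corners {ι : Type*} (U : Ultrafilter ι) {e : ι → A} {C : ℝ}
    (hC : ∀ i, ‖e i‖ ≤ C) (hl : ∀ a, Tendsto (fun i => e i * a) U (𝓝 a))
    (hr : ∀ a, Tendsto (fun i => a * e i) U (𝓝 a)) (M : BanachBimodule 𝕜 A E)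
    (D : A →L[𝕜] StrongDual 𝕜 E)
    (hD : ∀ a b : A, D (a * b) = M.dualRight (D a) b + M.dualLeft a (D b))
    (f : ι → StrongDual 𝕜 E) {B : ℝ} (hf : ∀ i, ‖f i‖ ≤ B)
    (hcomm : ∀ i a x, f i (M.right (e i * a * e i) x) - f i (M.left (e i * a * e i) x) =
      D (e i * a * e i) (M.right (e i) x)) :
    ∃ g : StrongDual 𝕜 E, ∀ a : A, D a = M.dualLeft a g - M.dualRight g a := by
  obtain ⟨i₀⟩ : Nonempty ι := U.neBot.nonempty
  have hC0 : 0 ≤ C := (norm_nonneg _).trans (hC i₀)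
  have hB0 : 0 ≤ B := (norm_nonneg _).trans (hf i₀)
  refine exists_inner_of_approx_inner U hC hl hr M D hD f hf fun a x => ?_
  -- Written as (a - e i * a) - e i * (a * e i - a), where boundedness of e controls the second
  -- term.
  have hw : Tendsto (fun i => a - e i * a * e i) U (𝓝 0) := by
    have h1 : Tendsto (fun i => e i * (a * e i - a)) U (𝓝 0) := by
      refine squeeze_zero_norm (a := fun i => C * ‖a * e i - a‖) (fun i => ?_) ?_
      · exact (norm_mul_le _ _).trans (by gcongr; exact hC i)
      · simpa using ((hr a).sub_const a).norm.const_mul C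
    have h2 : Tendsto (fun i => a - e i * a) U (𝓝 0) := by
      simpa using (hl a).const_sub a
    have h3 := h2.sub h1
    rw [sub_zero] at h3
    refine h3.congr fun i => ?_
    rw [mul_sub, mul_assoc]
    abel
  refine squeeze_zero_norm (a := fun i => (B * ‖M.right‖ * ‖x‖ + B * ‖M.left‖ * ‖x‖ +
    ‖D‖ * (‖M.right‖ * C * ‖x‖)) * ‖a - e i * a * e i‖) (fun i => ?_) (by
      simpa using hw.norm.const_mul _)
  have h1 := hcomm i a x
  set w := e i * a * e i
  -- Subtracting the exact identity for w leaves an expression linear in a - w, which tends to 0.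
  have h2 : f i (M.right a x) - f i (M.left a x) - D a (M.right (e i) x) =
      f i (M.right (a - w) x) - f i (M.left (a - w) x) - D (a - w) (M.right (e i) x) := by
    simp only [map_sub, sub_apply]
    linear_combination h1
  rw [h2]
  have h3 : ‖f i (M.right (a - w) x)‖ ≤ B * (‖M.right‖ * ‖a - w‖ * ‖x‖) :=
    ((f i).le_of_opNorm_le (hf i) _).trans (by gcongr; exact M.right.le_opNorm₂ _ _)
  have h4 : ‖f i (M.left (a - w) x)‖ ≤ B * (‖M.left‖ * ‖a - w‖ * ‖x‖) :=
    ((f i).le_of_opNorm_le (hf i) _).trans (by gcongr; exact M.left.le_opNorm₂ _ _)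
  have h5 : ‖D (a - w) (M.right (e i) x)‖ ≤ ‖D‖ * ‖a - w‖ * (‖M.right‖ * C * ‖x‖) :=
    (D.le_opNorm₂ _ _).trans (by
      gcongr
      exact (M.right.le_opNorm₂ _ _).trans (by gcongr; exact hC i))
  have h6 := norm_sub_le (f i (M.right (a - w) x) - f i (M.left (a - w) x))
    (D (a - w) (M.right (e i) x))
  have h7 := norm_sub_le (f i (M.right (a - w) x)) (f i (M.left (a - w) x))
  linarith

end InnerForm

/-! ### From generalized diagonals to amenability -/

section DiagonalToInner

variable {𝕜 : Type*} [RCLike 𝕜] {X : Type*} [NormedAddCommGroup X] [NormedSpace 𝕜 X]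
  [CompleteSpace X]

/-- The operators between the ranges of two projections, regarded as elements of `A(X)`. -/
def corner (p q : ApproxProj 𝕜 X) : (p.rg →L[𝕜] q.rg) →L[𝕜] approximable 𝕜 X :=
  sandwich q.incl p.proj

theorem norm_corner_le {p : ApproxProj 𝕜 X} (q : ApproxProj 𝕜 X) {C : ℝ} (hp : ‖p.op‖ ≤ C) :
    ‖corner p q‖ ≤ C := by
  refine (norm_sandwich_le _ _).trans ?_
  have h1 := q.norm_incl_le
  have h2 := p.norm_proj_le.trans hp
  calc ‖q.incl‖ * ‖p.proj‖ ≤ 1 * C := by gcongr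
    _ = C := one_mul C

/-- The projection fixes its range, so projecting between the two factors does nothing. This lets
products of operators between ranges be computed in A(X). -/
theorem corner_comp {p q r : ApproxProj 𝕜 X} (U : q.rg →L[𝕜] r.rg) (V : p.rg →L[𝕜] q.rg) :
    corner p r (U.comp V) = corner q r U * corner p q V := by
  refine Subtype.ext (ContinuousLinearMap.ext fun x => ?_)
  change (U (V (p.proj x)) : X) = U (q.proj (V (p.proj x)))
  rw [q.proj_coe]

theorem corner_id (p : ApproxProj 𝕜 X) : corner p p (ContinuousLinearMap.id 𝕜 _) = p.1 := rfl

/-- The inclusion of the finite-rank operators between the ranges of two projections in `A(X)`. -/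
def cornerF (p q : ApproxProj 𝕜 X) : finiteRank 𝕜 p.rg q.rg →L[𝕜] approximable 𝕜 X :=
  (corner p q).comp (finiteRank 𝕜 p.rg q.rg).subtypeL

theorem norm_cornerF_le {p : ApproxProj 𝕜 X} (q : ApproxProj 𝕜 X) {C : ℝ} (hp : ‖p.op‖ ≤ C) :
    ‖cornerF p q‖ ≤ C := by
  refine (ContinuousLinearMap.opNorm_comp_le _ _).trans ?_
  have h1 := norm_corner_le q hp
  have h2 := (finiteRank 𝕜 p.rg q.rg).norm_subtypeL_le
  have h3 : 0 ≤ C := (norm_nonneg _).trans hp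
  calc _ ≤ C * 1 := by gcongr
    _ = C := mul_one C

theorem prodMap_eq_id_of_isGeneralizedDiagonal {p q : ApproxProj 𝕜 X} [CompleteSpace p.rg]
    {Δ : ProjTensor 𝕜 (finiteRank 𝕜 q.rg p.rg) (finiteRank 𝕜 p.rg q.rg)}
    (hΔ : IsGeneralizedDiagonal (finiteRankAlg 𝕜 p.rg) Δ) :
    prodMap 𝕜 p.rg q.rg Δ = ContinuousLinearMap.id 𝕜 _ :=
  hΔ.2 (ContinuousLinearMap.id 𝕜 _) (mem_finiteRank_of_dom _)

theorem corner_prodMap_ptmul (p q : ApproxProj 𝕜 X) [CompleteSpace p.rg]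
    (U : finiteRank 𝕜 q.rg p.rg) (V : finiteRank 𝕜 p.rg q.rg) :
    (corner p p).comp (prodMap 𝕜 p.rg q.rg) (ptmul 𝕜 U V) = cornerF q p U * cornerF p q V :=
  (congrArg (corner p p) (prodMap_ptmul U V)).trans (corner_comp U.1 V.1)

theorem cornerF_postcomp {p q : ApproxProj 𝕜 X} (W : p.rg →L[𝕜] p.rg)
    (U : finiteRank 𝕜 q.rg p.rg) : cornerF q p (postcomp W U) = corner p p W * cornerF q p U :=
  corner_comp W U.1

theorem cornerF_precomp {p q : ApproxProj 𝕜 X} (W : p.rg →L[𝕜] p.rg)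
    (V : finiteRank 𝕜 p.rg q.rg) : cornerF p q (precomp W V) = cornerF p q V * corner p p W :=
  corner_comp V.1 W

/-- Inside A(X) the identity of the range becomes the projection itself; this is why D is evaluated
at x · p and not at x. -/
theorem projLift_innerForm_eq_of_isGeneralizedDiagonal {E : Type*} [NormedAddCommGroup E]
    [NormedSpace 𝕜 E] (M : BanachBimodule 𝕜 (approximable 𝕜 X) E)
    (D : approximable 𝕜 X →L[𝕜] StrongDual 𝕜 E)
    (hD : ∀ a b, D (a * b) = M.dualRight (D a) b + M.dualLeft a (D b)) {p q : ApproxProj 𝕜 X}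
    {Δ : ProjTensor 𝕜 (finiteRank 𝕜 q.rg p.rg) (finiteRank 𝕜 p.rg q.rg)}
    (hΔ : IsGeneralizedDiagonal (finiteRankAlg 𝕜 p.rg) Δ) (W : p.rg →L[𝕜] p.rg) (x : E) :
    projLift (innerForm M D (cornerF q p) (cornerF p q)) Δ (M.right (corner p p W) x) -
        projLift (innerForm M D (cornerF q p) (cornerF p q)) Δ (M.left (corner p p W) x) =
      D (corner p p W) (M.right p.1 x) := by
  have : CompleteSpace p.rg := FiniteDimensional.complete 𝕜 p.rg
  have hm : (corner p p).comp (prodMap 𝕜 p.rg q.rg) Δ = p.1 :=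
    congrArg (corner p p) (prodMap_eq_id_of_isGeneralizedDiagonal hΔ)
  exact projLift_innerForm_commutator M D hD (cornerF q p) (cornerF p q)
    (L := postcomp W) (R := precomp W) (cornerF_postcomp W) (cornerF_precomp W) (corner_prodMap_ptmul p q) hm x
    (hΔ.1 W (mem_finiteRank_of_dom W))

/-- A bounded family of generalized diagonals makes `A(X)` amenable. -/
theorem isAmenable_of_diagonals {ι : Type*} (U : Ultrafilter ι) (P : ι → ApproxProj 𝕜 X) {C K : ℝ}
    (hC : ∀ i, ‖(P i).op‖ ≤ C)
    (hl : ∀ a : approximable 𝕜 X, Tendsto (fun i => (P i).1 * a) U (𝓝 a))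
    (hr : ∀ a : approximable 𝕜 X, Tendsto (fun i => a * (P i).1) U (𝓝 a))
    (h : ∀ i, ∃ j, ∃ Δ : ProjTensor 𝕜 (finiteRank 𝕜 (P j).rg (P i).rg)
      (finiteRank 𝕜 (P i).rg (P j).rg),
        IsGeneralizedDiagonal (finiteRankAlg 𝕜 (P i).rg) Δ ∧ ‖Δ‖ ≤ K) :
    IsAmenable 𝕜 (approximable 𝕜 X) := by
  intro E _ _ _ M D hD
  obtain ⟨i₀⟩ : Nonempty ι := U.neBot.nonempty
  have hC0 : 0 ≤ C := (norm_nonneg _).trans (hC i₀)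
  choose j Δ hΔ hK using h
  exact exists_inner_of_inner_on_corners U (e := fun i => (P i).1) hC hl hr M D hD
    (fun i => projLift (innerForm M D (cornerF (P (j i)) (P i)) (cornerF (P i) (P (j i)))) (Δ i))
    (fun i => (norm_projLift_apply_le _ _).trans
      (mul_le_mul (norm_innerForm_le M D (norm_cornerF_le _ (hC _)) (norm_cornerF_le _ (hC _)))
        (hK i) (norm_nonneg _) (by positivity)))
    -- Every element P a P is the corner of the compression of a to the range of P.
    fun i a x => projLift_innerForm_eq_of_isGeneralizedDiagonal M D hD (hΔ i)
      ((P i).proj.comp (a.1.comp (P i).incl)) x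

end DiagonalToInner

/-! ### Identities and limits checked on elementary tensors -/

section TensorMaps

variable {𝕜 : Type*} [RCLike 𝕜] {E F E' F' E'' F'' W ι : Type*}
  [NormedAddCommGroup E] [NormedSpace 𝕜 E] [NormedAddCommGroup F] [NormedSpace 𝕜 F]
  [NormedAddCommGroup E'] [NormedSpace 𝕜 E'] [NormedAddCommGroup F'] [NormedSpace 𝕜 F']
  [NormedAddCommGroup E''] [NormedSpace 𝕜 E''] [NormedAddCommGroup F''] [NormedSpace 𝕜 F'']
  [NormedAddCommGroup W] [NormedSpace 𝕜 W]

theorem projMap_projMap (S' : E' →L[𝕜] E'') (T' : F' →L[𝕜] F'') (S : E →L[𝕜] E') (T : F →L[𝕜] F')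
    (t : ProjTensor 𝕜 E F) :
    projMap S' T' (projMap S T t) = projMap (S'.comp S) (T'.comp T) t := by
  have h : (projMap S' T').comp (projMap S T) = projMap (S'.comp S) (T'.comp T) := by
    refine projTensor_ext fun x y => ?_
    simp only [ContinuousLinearMap.comp_apply, projMap_ptmul]
  exact congrArg (fun L => L t) h

theorem apply_projMap_eq {S : E →L[𝕜] E'} {T : F →L[𝕜] F'} {S' : E →L[𝕜] E''} {T' : F →L[𝕜] F''}
    {φ : ProjTensor 𝕜 E' F' →L[𝕜] W} {ψ : ProjTensor 𝕜 E'' F'' →L[𝕜] W}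
    (h : ∀ x y, φ (ptmul 𝕜 (S x) (T y)) = ψ (ptmul 𝕜 (S' x) (T' y))) (t : ProjTensor 𝕜 E F) :
    φ (projMap S T t) = ψ (projMap S' T' t) := by
  have h1 : φ.comp (projMap S T) = ψ.comp (projMap S' T') := by
    refine projTensor_ext fun x y => ?_
    simpa only [ContinuousLinearMap.comp_apply, projMap_ptmul] using h x y
  exact congrArg (fun L => L t) h1

/-- The operator `∑ Sᵢ ⊗ Tᵢ` on a projective tensor product. -/
def projMapSum [Fintype ι] (S : ι → E →L[𝕜] E') (T : ι → F →L[𝕜] F') :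
    ProjTensor 𝕜 E F →L[𝕜] ProjTensor 𝕜 E' F' :=
  ∑ i, projMap (S i) (T i)

theorem projMapSum_ptmul [Fintype ι] (S : ι → E →L[𝕜] E') (T : ι → F →L[𝕜] F') (x : E) (y : F) :
    projMapSum S T (ptmul 𝕜 x y) = ∑ i, ptmul 𝕜 (S i x) (T i y) := by
  simp only [projMapSum, sum_apply, projMap_ptmul]

theorem projMap_projMapSum_eq [Fintype ι] {S : ι → E →L[𝕜] E'} {T : ι → F →L[𝕜] F'}
    {L : E' →L[𝕜] E'} {R : F' →L[𝕜] F'}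
    (h : ∀ x y, ∑ i, ptmul 𝕜 (L (S i x)) (T i y) = ∑ i, ptmul 𝕜 (S i x) (R (T i y)))
    (t : ProjTensor 𝕜 E F) :
    projMap L (ContinuousLinearMap.id 𝕜 F') (projMapSum S T t) =
      projMap (ContinuousLinearMap.id 𝕜 E') R (projMapSum S T t) := by
  have h1 : (projMap L (ContinuousLinearMap.id 𝕜 F')).comp (projMapSum S T) =
      (projMap (ContinuousLinearMap.id 𝕜 E') R).comp (projMapSum S T) := by
    refine projTensor_ext fun x y => ?_
    simpa only [ContinuousLinearMap.comp_apply, projMapSum_ptmul, map_sum, projMap_ptmul,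
      ContinuousLinearMap.id_apply] using h x y
  exact congrArg (fun L => L t) h1

theorem apply_projMapSum_eq [Fintype ι] {S : ι → E →L[𝕜] E} {T : ι → F →L[𝕜] F}
    {φ : ProjTensor 𝕜 E F →L[𝕜] W}
    (h : ∀ x y, ∑ i, φ (ptmul 𝕜 (S i x) (T i y)) = φ (ptmul 𝕜 x y)) (t : ProjTensor 𝕜 E F) :
    φ (projMapSum S T t) = φ t := by
  have h1 : φ.comp (projMapSum S T) = φ := by
    refine projTensor_ext fun x y => ?_
    simpa only [ContinuousLinearMap.comp_apply, projMapSum_ptmul, map_sum] using h x y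
  exact congrArg (fun L => L t) h1

/-- A uniformly bounded family of operators on a projective tensor product that converges on
elementary tensors converges pointwise. -/
theorem tendsto_of_tendsto_ptmul {l : Filter ι} {L : ι → ProjTensor 𝕜 E F →L[𝕜] W} {L₀ : ProjTensor 𝕜 E F →L[𝕜] W} {C : ℝ}
    (hC0 : 0 ≤ C) (hC : ∀ i t, ‖L i t‖ ≤ C * ‖t‖)
    (h : ∀ x y, Tendsto (fun i => L i (ptmul 𝕜 x y)) l (𝓝 (L₀ (ptmul 𝕜 x y))))
    (t : ProjTensor 𝕜 E F) : Tendsto (fun i => L i t) l (𝓝 (L₀ t)) := by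
  refine tendsto_apply_of_mem_closure (s := ptmulSpan 𝕜 E F)
    (fun i => ContinuousLinearMap.opNorm_le_bound _ hC0 (hC i)) (fun v hv => ?_)
    (mem_closure_ptmulSpan t)
  replace hv : v ∈ ptmulSpan 𝕜 E F := hv
  induction hv using Submodule.span_induction with
  | zero => simpa only [map_zero] using tendsto_const_nhds
  | mem v hv =>
    obtain ⟨x, y, rfl⟩ := hv
    exact h x y
  | add v w _ _ hv hw => simpa only [map_add] using hv.add hw
  | smul c v _ hv => simpa only [map_smul] using hv.const_smul c

/-- The functionals `φ` on a projective tensor product such that `φ ∘ (S i ⊗ T i)` tends to `φ` on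
elementary tensors satisfy the same on all tensors, if `S` and `T` are bounded. -/
theorem tendsto_apply_projMap {l : Filter ι} {φ : ProjTensor 𝕜 E F →L[𝕜] W} {S : ι → E →L[𝕜] E}
    {T : ι → F →L[𝕜] F} {B C : ℝ} (hB0 : 0 ≤ B) (hC0 : 0 ≤ C) (hS : ∀ i, ‖S i‖ ≤ B)
    (hT : ∀ i, ‖T i‖ ≤ C)
    (h : ∀ x y, Tendsto (fun i => φ (ptmul 𝕜 (S i x) (T i y))) l (𝓝 (φ (ptmul 𝕜 x y))))
    (t : ProjTensor 𝕜 E F) :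
    Tendsto (fun i => φ (projMap (S i) (T i) t)) l (𝓝 (φ t)) := by
  refine tendsto_of_tendsto_ptmul (L := fun i => φ.comp (projMap (S i) (T i))) (L₀ := φ)
    (C := ‖φ‖ * (B * C)) (by positivity) (fun i t => ?_) (fun x y => ?_) t
  · rw [mul_assoc]
    refine φ.le_opNorm_of_le ((norm_projMap_apply_le _ _ t).trans ?_)
    have h1 := hS i
    have h2 := hT i
    gcongr
  · simpa only [ContinuousLinearMap.comp_apply, projMap_ptmul] using h x y

end TensorMaps

/-! ### Central tensors, averaging, and the Hahn–Banach bound -/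

section Averaging

variable {𝕜 : Type*} [RCLike 𝕜]

/-- If a functional takes the value `1` on no element of norm at most `K` of a subspace, then its
restriction to the subspace extends to a functional of norm at most `1 / K`. -/
theorem exists_extension_norm_le {V : Type*} [NormedAddCommGroup V] [NormedSpace 𝕜 V]
    (T : Submodule 𝕜 V) (τ : StrongDual 𝕜 V) {K : ℝ} (hK : 0 < K)
    (h : ∀ v ∈ T, τ v = 1 → K < ‖v‖) :
    ∃ φ : StrongDual 𝕜 V, ‖φ‖ ≤ K⁻¹ ∧ ∀ v ∈ T, φ v = τ v := by
  obtain ⟨φ, hφ, hnorm⟩ := exists_extension_norm_eq T (τ.comp T.subtypeL)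
  refine ⟨φ, ?_, fun v hv => hφ ⟨v, hv⟩⟩
  rw [hnorm]
  refine ContinuousLinearMap.opNorm_le_bound _ (by positivity) fun v => ?_
  change ‖τ v‖ ≤ K⁻¹ * ‖(v : V)‖
  by_cases h0 : τ v = 0
  · rw [h0, norm_zero]
    positivity
  have h1 := h ((τ v)⁻¹ • (v : V)) (T.smul_mem _ v.2) (by simp [h0])
  have h2 : 0 < ‖τ v‖ := norm_pos_iff.2 h0
  rw [norm_smul, norm_inv, lt_inv_mul_iff₀ h2] at h1
  rw [le_inv_mul_iff₀ hK]
  linarith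

/-- The subspace on which two families of operators agree. -/
def equalizer {J V W : Type*} [NormedAddCommGroup V] [NormedSpace 𝕜 V] [NormedAddCommGroup W]
    [NormedSpace 𝕜 W] (L R : J → V →L[𝕜] W) : Submodule 𝕜 V where
  carrier := {v | ∀ j, L j v = R j v}
  zero_mem' j := (map_zero _).trans (map_zero _).symm
  add_mem' hv hw j := by rw [map_add, map_add, hv j, hw j]
  smul_mem' c v hv j := by rw [map_smul, map_smul, hv j]

variable {Y Z : Type*} [NormedAddCommGroup Y] [NormedSpace 𝕜 Y] [NormedAddCommGroup Z]
  [NormedSpace 𝕜 Z]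

/-- The left action of an operator on tensors, as a bounded operator. -/
def leftActL (W : Y →L[𝕜] Y) :
    ProjTensor 𝕜 (finiteRank 𝕜 Z Y) (finiteRank 𝕜 Y Z) →L[𝕜]
      ProjTensor 𝕜 (finiteRank 𝕜 Z Y) (finiteRank 𝕜 Y Z) :=
  projMap (postcomp W) (ContinuousLinearMap.id 𝕜 (finiteRank 𝕜 Y Z))

/-- The right action of an operator on tensors, as a bounded operator. -/
def rightActL (W : Y →L[𝕜] Y) :
    ProjTensor 𝕜 (finiteRank 𝕜 Z Y) (finiteRank 𝕜 Y Z) →L[𝕜]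
      ProjTensor 𝕜 (finiteRank 𝕜 Z Y) (finiteRank 𝕜 Y Z) :=
  projMap (ContinuousLinearMap.id 𝕜 (finiteRank 𝕜 Z Y)) (precomp W)

variable (𝕜 Y Z) in
/-- The tensors commuting with all operators. -/
def centralTensors : Submodule 𝕜 (ProjTensor 𝕜 (finiteRank 𝕜 Z Y) (finiteRank 𝕜 Y Z)) :=
  equalizer leftActL rightActL

/-- The functional `Δ ↦ f (π(Δ) u)`. -/
def evalProd [CompleteSpace Y] (u : Y) (f : StrongDual 𝕜 Y) :
    StrongDual 𝕜 (ProjTensor 𝕜 (finiteRank 𝕜 Z Y) (finiteRank 𝕜 Y Z)) :=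
  (f.comp (ContinuousLinearMap.apply 𝕜 Y u)).comp (prodMap 𝕜 Y Z)

theorem evalProd_ptmul [CompleteSpace Y] (u : Y) (f : StrongDual 𝕜 Y) (U : finiteRank 𝕜 Z Y)
    (V : finiteRank 𝕜 Y Z) : evalProd u f (ptmul 𝕜 U V) = f (U.1 (V.1 u)) :=
  congrArg (fun T => f (T u)) (prodMap_ptmul U V)

/-- The product of a central tensor is a multiple of the identity. -/
theorem prodMap_eq_smul_of_central [CompleteSpace Y] {u : Y} {f : StrongDual 𝕜 Y} (hu : f u = 1)
    {Δ : ProjTensor 𝕜 (finiteRank 𝕜 Z Y) (finiteRank 𝕜 Y Z)} (hΔ : Δ ∈ centralTensors 𝕜 Y Z) :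
    prodMap 𝕜 Y Z Δ = evalProd u f Δ • ContinuousLinearMap.id 𝕜 Y := by
  ext x
  -- Commuting with the rank-one operator x ⊗ f and evaluating at u gives f(π(Δ)u) x = π(Δ)x, as
  -- f(u) = 1.
  have h1 := (prodMap_leftAct (f.smulRight x) Δ).symm.trans
    ((congrArg (prodMap 𝕜 Y Z) (hΔ (f.smulRight x))).trans (prodMap_rightAct (f.smulRight x) Δ))
  have h2 := congrArg (fun T : Y →L[𝕜] Y => T u) h1
  simp only [ContinuousLinearMap.comp_apply, ContinuousLinearMap.smulRight_apply, hu,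
    one_smul] at h2
  exact h2.symm

/-- The bilinear map `(x, g) ↦ (x ⊗ f) U ⊗ V (u ⊗ g)`. -/
def rankOneForm (u : Y) (f : StrongDual 𝕜 Y) (U : finiteRank 𝕜 Z Y) (V : finiteRank 𝕜 Y Z) :
    Y →ₗ[𝕜] StrongDual 𝕜 Y →ₗ[𝕜] ProjTensor 𝕜 (finiteRank 𝕜 Z Y) (finiteRank 𝕜 Y Z) :=
  (ptmulL 𝕜 (finiteRank 𝕜 Z Y) (finiteRank 𝕜 Y Z)).toLinearMap₁₂.compl₁₂
    { toFun := fun x => postcomp (f.smulRight x) U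
      map_add' := fun x y => Subtype.ext (ContinuousLinearMap.ext fun _ => smul_add _ x y)
      map_smul' := fun c x => Subtype.ext (ContinuousLinearMap.ext fun _ => smul_comm _ c x) }
    { toFun := fun g => precomp (g.smulRight u) V
      map_add' := fun g h => Subtype.ext (ContinuousLinearMap.ext fun z =>
        (congrArg V.1 (add_smul (g z) (h z) u)).trans (map_add V.1 _ _))
      map_smul' := fun c g => Subtype.ext (ContinuousLinearMap.ext fun z =>
        (congrArg V.1 (mul_smul c (g z) u)).trans (map_smul V.1 _ _)) }

theorem rankOneForm_apply (u : Y) (f : StrongDual 𝕜 Y) (U : finiteRank 𝕜 Z Y)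
    (V : finiteRank 𝕜 Y Z) (x : Y) (g : StrongDual 𝕜 Y) :
    rankOneForm u f U V x g =
      ptmul 𝕜 (postcomp (f.smulRight x) U) (precomp (g.smulRight u) V) :=
  ptmulL_apply _ _

variable [FiniteDimensional 𝕜 Y]

variable (𝕜 Y) in
/-- The coordinate functionals of a basis of a finite-dimensional space. -/
def coordL (i : Fin (Module.finrank 𝕜 Y)) : StrongDual 𝕜 Y :=
  LinearMap.toContinuousLinearMap ((Module.finBasis 𝕜 Y).coord i)

theorem sum_coordL_smul (x : Y) : ∑ i, coordL 𝕜 Y i x • Module.finBasis 𝕜 Y i = x :=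
  (Module.finBasis 𝕜 Y).sum_repr x

theorem sum_smul_coordL (f : StrongDual 𝕜 Y) :
    ∑ i, f (Module.finBasis 𝕜 Y i) • coordL 𝕜 Y i = f := by
  ext x
  conv_rhs => rw [← sum_coordL_smul (𝕜 := 𝕜) x, map_sum]
  simp [sum_apply, mul_comm]

/-- The canonical tensor `∑ bᵢ ⊗ bᵢ*` commutes with operators. -/
theorem sum_bilin_basis {H : Type*} [AddCommGroup H] [Module 𝕜 H]
    (β : Y →ₗ[𝕜] StrongDual 𝕜 Y →ₗ[𝕜] H) (W : Y →L[𝕜] Y) :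
    ∑ i, β (W (Module.finBasis 𝕜 Y i)) (coordL 𝕜 Y i) =
      ∑ i, β (Module.finBasis 𝕜 Y i) ((coordL 𝕜 Y i).comp W) := by
  have h1 : ∀ i, β (W (Module.finBasis 𝕜 Y i)) (coordL 𝕜 Y i) =
      ∑ k, coordL 𝕜 Y k (W (Module.finBasis 𝕜 Y i)) •
        β (Module.finBasis 𝕜 Y k) (coordL 𝕜 Y i) := fun i => by
    conv_lhs => rw [← sum_coordL_smul (𝕜 := 𝕜) (W (Module.finBasis 𝕜 Y i))]
    simp [LinearMap.sum_apply]
  have h2 : ∀ k, β (Module.finBasis 𝕜 Y k) ((coordL 𝕜 Y k).comp W) =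
      ∑ i, coordL 𝕜 Y k (W (Module.finBasis 𝕜 Y i)) •
        β (Module.finBasis 𝕜 Y k) (coordL 𝕜 Y i) := fun k => by
    conv_lhs => rw [← sum_smul_coordL ((coordL 𝕜 Y k).comp W)]
    simp
  simp only [h1, h2]
  exact Finset.sum_comm

/-- The averaging operator `Δ ↦ ∑ (bᵢ ⊗ f) Δ (u ⊗ bᵢ*)`. -/
def average (u : Y) (f : StrongDual 𝕜 Y) :
    ProjTensor 𝕜 (finiteRank 𝕜 Z Y) (finiteRank 𝕜 Y Z) →L[𝕜]
      ProjTensor 𝕜 (finiteRank 𝕜 Z Y) (finiteRank 𝕜 Y Z) :=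
  projMapSum (fun i => postcomp (f.smulRight (Module.finBasis 𝕜 Y i)))
    fun i => precomp ((coordL 𝕜 Y i).smulRight u)

/-- On U ⊗ V the average multiplies f(UVu) by ∑ f(bᵢ) bᵢ*(u) = f(u) = 1. -/
theorem evalProd_average [CompleteSpace Y] {u : Y} {f : StrongDual 𝕜 Y} (hu : f u = 1)
    (Δ : ProjTensor 𝕜 (finiteRank 𝕜 Z Y) (finiteRank 𝕜 Y Z)) :
    evalProd u f (average u f Δ) = evalProd u f Δ := by
  refine apply_projMapSum_eq (fun U V => ?_) Δ
  have h1 := congrArg f (sum_coordL_smul (𝕜 := 𝕜) u)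
  rw [map_sum, hu] at h1
  simp only [map_smul, smul_eq_mul] at h1
  have h2 : ∀ i, evalProd u f (ptmul 𝕜 (postcomp (f.smulRight (Module.finBasis 𝕜 Y i)) U)
      (precomp ((coordL 𝕜 Y i).smulRight u) V)) =
        coordL 𝕜 Y i u * f (Module.finBasis 𝕜 Y i) * f (U.1 (V.1 u)) := fun i => by
    refine (evalProd_ptmul _ _ _ _).trans ?_
    change f (f (U.1 (V.1 (coordL 𝕜 Y i u • u))) • Module.finBasis 𝕜 Y i) = _
    simp only [map_smul, smul_eq_mul]
    ring
  rw [Finset.sum_congr rfl fun i _ => h2 i, ← Finset.sum_mul, h1, one_mul]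
  exact (evalProd_ptmul _ _ _ _).symm

/-- The bᵢ and bᵢ* enter bilinearly through the canonical tensor ∑ bᵢ ⊗ bᵢ*, on which W may act from
either side with the same result. -/
theorem average_mem (u : Y) (f : StrongDual 𝕜 Y)
    (Δ : ProjTensor 𝕜 (finiteRank 𝕜 Z Y) (finiteRank 𝕜 Y Z)) :
    average u f Δ ∈ centralTensors 𝕜 Y Z := by
  intro W
  refine projMap_projMapSum_eq (L := postcomp (X := Z) W) (R := precomp (Z := Z) W) (fun U V => ?_) Δ
  refine Eq.trans (Finset.sum_congr rfl fun i _ => ?_)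
    ((sum_bilin_basis (rankOneForm u f U V) W).trans (Finset.sum_congr rfl fun i _ => ?_))
  · have h : postcomp W (postcomp (f.smulRight (Module.finBasis 𝕜 Y i)) U) =
        postcomp (f.smulRight (W (Module.finBasis 𝕜 Y i))) U :=
      Subtype.ext (ContinuousLinearMap.ext fun z => map_smul W _ _)
    exact (congrArg (fun T => ptmul 𝕜 T _) h).trans (rankOneForm_apply _ _ _ _ _ _).symm
  · exact rankOneForm_apply _ _ _ _ _ _

end Averaging

/-! ### Replacing the middle space X by the range of a projection -/

section Truncation

variable {𝕜 : Type*} [RCLike 𝕜] {X Y Z : Type*} [NormedAddCommGroup X] [NormedSpace 𝕜 X]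
  [NormedAddCommGroup Y] [NormedSpace 𝕜 Y] [NormedAddCommGroup Z] [NormedSpace 𝕜 Z]

/-- The map `U ⊗ V ↦ U S ⊗ R V` between tensors. -/
def truncate (Y : Type*) [NormedAddCommGroup Y] [NormedSpace 𝕜 Y] (S : Z →L[𝕜] X) (R : X →L[𝕜] Z) :
    ProjTensor 𝕜 (finiteRank 𝕜 X Y) (finiteRank 𝕜 Y X) →L[𝕜]
      ProjTensor 𝕜 (finiteRank 𝕜 Z Y) (finiteRank 𝕜 Y Z) :=
  projMap (precomp S) (postcomp R)

theorem norm_truncate_apply_le (S : Z →L[𝕜] X) (R : X →L[𝕜] Z)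
    (Δ : ProjTensor 𝕜 (finiteRank 𝕜 X Y) (finiteRank 𝕜 Y X)) :
    ‖truncate Y S R Δ‖ ≤ ‖S‖ * ‖R‖ * ‖Δ‖ := by
  refine (norm_projMap_apply_le _ _ Δ).trans ?_
  gcongr
  · exact norm_precomp_le S
  · exact norm_postcomp_le R

-- The actions of W compose on the outer side of each factor and truncation on the inner side, so
-- they commute.
set_option maxHeartbeats 1000000 in
theorem truncate_mem_centralTensors (S : Z →L[𝕜] X) (R : X →L[𝕜] Z)
    {Δ : ProjTensor 𝕜 (finiteRank 𝕜 X Y) (finiteRank 𝕜 Y X)} (hΔ : Δ ∈ centralTensors 𝕜 Y X) :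
    truncate Y S R Δ ∈ centralTensors 𝕜 Y Z := by
  intro W
  have h1 : leftActL W (truncate Y S R Δ) = truncate Y S R (leftActL W Δ) :=
    (projMap_projMap (E := finiteRank 𝕜 X Y) (F := finiteRank 𝕜 Y X)
      (E' := finiteRank 𝕜 Z Y) (F' := finiteRank 𝕜 Y Z)
      (E'' := finiteRank 𝕜 Z Y) (F'' := finiteRank 𝕜 Y Z)
      (postcomp W) (ContinuousLinearMap.id 𝕜 _) (precomp S) (postcomp R) Δ).trans
    (projMap_projMap (E := finiteRank 𝕜 X Y) (F := finiteRank 𝕜 Y X)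
      (E' := finiteRank 𝕜 X Y) (F' := finiteRank 𝕜 Y X)
      (E'' := finiteRank 𝕜 Z Y) (F'' := finiteRank 𝕜 Y Z)
      (precomp S) (postcomp R) (postcomp W) (ContinuousLinearMap.id 𝕜 _) Δ).symm
  have h2 : rightActL W (truncate Y S R Δ) = truncate Y S R (rightActL W Δ) :=
    (projMap_projMap (E := finiteRank 𝕜 X Y) (F := finiteRank 𝕜 Y X)
      (E' := finiteRank 𝕜 Z Y) (F' := finiteRank 𝕜 Y Z)
      (E'' := finiteRank 𝕜 Z Y) (F'' := finiteRank 𝕜 Y Z)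
      (ContinuousLinearMap.id 𝕜 _) (precomp W) (precomp S) (postcomp R) Δ).trans
    (projMap_projMap (E := finiteRank 𝕜 X Y) (F := finiteRank 𝕜 Y X)
      (E' := finiteRank 𝕜 X Y) (F' := finiteRank 𝕜 Y X)
      (E'' := finiteRank 𝕜 Z Y) (F'' := finiteRank 𝕜 Y Z)
      (precomp S) (postcomp R) (ContinuousLinearMap.id 𝕜 _) (precomp W) Δ).symm
  rw [h1, h2, hΔ W]

set_option maxHeartbeats 1000000 in
theorem evalProd_truncate [CompleteSpace Y] (S : Z →L[𝕜] X) (R : X →L[𝕜] Z) (u : Y)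
    (f : StrongDual 𝕜 Y) (Δ : ProjTensor 𝕜 (finiteRank 𝕜 X Y) (finiteRank 𝕜 Y X)) :
    evalProd u f (truncate Y S R Δ) =
      evalProd u f (projMap (ContinuousLinearMap.id 𝕜 (finiteRank 𝕜 X Y))
        (postcomp (X := Y) (S.comp R)) Δ) := by
  exact apply_projMap_eq (E := finiteRank 𝕜 X Y) (F := finiteRank 𝕜 Y X)
    (E' := finiteRank 𝕜 Z Y) (F' := finiteRank 𝕜 Y Z) (E'' := finiteRank 𝕜 X Y)
    (F'' := finiteRank 𝕜 Y X) (W := 𝕜) (φ := evalProd u f) (ψ := evalProd u f)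
    (S := precomp S) (T := postcomp R)
    (S' := ContinuousLinearMap.id 𝕜 _) (T' := postcomp (S.comp R))
    (fun U V => (evalProd_ptmul u f (precomp S U) (postcomp R V)).trans
      (evalProd_ptmul u f U (postcomp (S.comp R) V)).symm) Δ

set_option maxHeartbeats 1000000 in
/-- Truncation by projections that converge strongly to the identity preserves the functional
`Δ ↦ f (π(Δ) u)` in the limit. -/
theorem tendsto_evalProd_truncate [CompleteSpace Y] {ι : Type*} {l : Filter ι}
    (P : ι → ApproxProj 𝕜 X) {C : ℝ}
    (hC0 : 0 ≤ C) (hC : ∀ i, ‖(P i).op‖ ≤ C) (h : ∀ x, Tendsto (fun i => (P i).op x) l (𝓝 x)) (u : Y)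
    (f : StrongDual 𝕜 Y) (Δ : ProjTensor 𝕜 (finiteRank 𝕜 X Y) (finiteRank 𝕜 Y X)) :
    Tendsto (fun i => evalProd u f (truncate Y (P i).incl (P i).proj Δ)) l
      (𝓝 (evalProd u f Δ)) := by
  refine Tendsto.congr (fun i => (evalProd_truncate (P i).incl (P i).proj u f Δ).symm) ?_
  refine tendsto_apply_projMap (E := finiteRank 𝕜 X Y) (F := finiteRank 𝕜 Y X) (W := 𝕜) (φ := evalProd (Z := X) u f)
    (S := fun _ => ContinuousLinearMap.id 𝕜 (finiteRank 𝕜 X Y))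
    (T := fun i => postcomp (X := Y) (P i).op) zero_le_one hC0
    (fun _ => ContinuousLinearMap.norm_id_le)
    (fun i => (norm_postcomp_le (P i).op).trans (hC i)) (fun U V => ?_) Δ
  have h1 : Tendsto (fun i => f (U.1 ((P i).op (V.1 u)))) l (𝓝 (f (U.1 (V.1 u)))) :=
    ((f.comp U.1).continuous.tendsto _).comp (h (V.1 u))
  rw [evalProd_ptmul]
  exact h1.congr fun i => (evalProd_ptmul u f U (postcomp (P i).op V)).symm

end Truncation

/-! ### Extracting bounded tensors from a central functional -/

section VirtualDiagonal

variable {𝕜 : Type*} [RCLike 𝕜] {A : Type*} [NonUnitalNormedRing A] [NormedSpace 𝕜 A]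
  {F G : Type*} [NormedAddCommGroup F] [NormedSpace 𝕜 F] [NormedAddCommGroup G] [NormedSpace 𝕜 G]

/-- The bilinear form `(a, b) ↦ φ (σ(a) ⊗ ρ(b))`. -/
def tensorForm (φ : StrongDual 𝕜 (ProjTensor 𝕜 F G)) (σ : A →L[𝕜] F) (ρ : A →L[𝕜] G) :
    A →L[𝕜] A →L[𝕜] 𝕜 :=
  ((ContinuousLinearMap.compL 𝕜 G (ProjTensor 𝕜 F G) 𝕜 φ).comp (ptmulL 𝕜 F G)).bilinearComp σ ρ

theorem tensorForm_apply (φ : StrongDual 𝕜 (ProjTensor 𝕜 F G)) (σ : A →L[𝕜] F) (ρ : A →L[𝕜] G)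
    (a b : A) : tensorForm φ σ ρ a b = φ (ptmul 𝕜 (σ a) (ρ b)) :=
  congrArg φ (ptmulL_apply _ _)

theorem norm_tensorForm_le (φ : StrongDual 𝕜 (ProjTensor 𝕜 F G)) (σ : A →L[𝕜] F)
    (ρ : A →L[𝕜] G) : ‖tensorForm φ σ ρ‖ ≤ ‖φ‖ * (‖σ‖ * ‖ρ‖) := by
  refine ContinuousLinearMap.opNorm_le_bound₂ _ (by positivity) fun a b => ?_
  rw [tensorForm_apply]
  calc ‖φ (ptmul 𝕜 (σ a) (ρ b))‖ ≤ ‖φ‖ * (‖σ a‖ * ‖ρ b‖) := φ.le_opNorm_of_le (norm_ptmul_le _ _)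
    _ ≤ ‖φ‖ * ((‖σ‖ * ‖a‖) * (‖ρ‖ * ‖b‖)) := by
        gcongr <;> exact ContinuousLinearMap.le_opNorm _ _
    _ = ‖φ‖ * (‖σ‖ * ‖ρ‖) * ‖a‖ * ‖b‖ := by ring

variable [IsScalarTower 𝕜 A A] [SMulCommClass 𝕜 A A]

/-- A functional of norm at most `m` on bilinear forms that commutes with the algebra. -/
structure CentralFunctional (𝕜 : Type*) [RCLike 𝕜] (A : Type*) [NonUnitalNormedRing A]
    [NormedSpace 𝕜 A] [IsScalarTower 𝕜 A A] [SMulCommClass 𝕜 A A] (m : ℝ) where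
  functional : StrongDual 𝕜 (A →L[𝕜] A →L[𝕜] 𝕜)
  central : ∀ a B, functional (bilinRight 𝕜 A a B) = functional (bilinLeft 𝕜 A a B)
  norm_le : ‖functional‖ ≤ m

/-- The value of a central functional at the form `(x, y) ↦ ψ (x y)`. -/
def CentralFunctional.mulValue {m : ℝ} (M : CentralFunctional 𝕜 A m) (ψ : StrongDual 𝕜 A) : 𝕜 :=
  M.functional (mulForm 𝕜 A ψ)

/-- Centrality moves each rᵢ from the second variable of the form to the first while sᵢ stays, which
creates the averaged form. -/
theorem CentralFunctional.apply_eq_sum {m : ℝ} (M : CentralFunctional 𝕜 A m) {ι : Type*}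
    [Fintype ι]
    (r s : ι → A) {B : A →L[𝕜] A →L[𝕜] 𝕜} (hB : bilinLeft 𝕜 A (∑ i, r i * s i) B = B) :
    M.functional B = M.functional (∑ i, bilinRight 𝕜 A (r i) (bilinLeft 𝕜 A (s i) B)) := by
  conv_lhs => rw [← hB]
  rw [map_sum, sum_apply, map_sum, map_sum]
  refine Finset.sum_congr rfl fun i _ => ?_
  rw [M.central, bilinLeft_mul]

/-- A central functional produces elements of bounded norm in the range of an averaging operator. -/
theorem CentralFunctional.exists_mem {m : ℝ} (M : CentralFunctional 𝕜 A m) {ι : Type*}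
    [Fintype ι]
    {r s : ι → A} {σ : A →L[𝕜] F} {ρ : A →L[𝕜] G} {S : ι → F →L[𝕜] F} {T : ι → G →L[𝕜] G}
    (hρ : ∀ b, ρ (b * ∑ i, r i * s i) = ρ b) (hS : ∀ i a, σ (r i * a) = S i (σ a))
    (hT : ∀ i b, ρ (b * s i) = T i (ρ b)) {N : Submodule 𝕜 (ProjTensor 𝕜 F G)}
    (hN : ∀ Δ, projMapSum S T Δ ∈ N) {τ : StrongDual 𝕜 (ProjTensor 𝕜 F G)}
    (hτ : ∀ Δ, τ (projMapSum S T Δ) = τ Δ) {ψ : StrongDual 𝕜 A}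
    (hψ : ∀ a b, τ (ptmul 𝕜 (σ a) (ρ b)) = ψ (a * b)) (hMψ : M.mulValue ψ = 1) {K : ℝ}
    (hK : m * (‖σ‖ * ‖ρ‖) < K) : ∃ Δ ∈ N, τ Δ = 1 ∧ ‖Δ‖ ≤ K := by
  by_contra! hcon
  have hm : 0 ≤ m := (norm_nonneg _).trans M.norm_le
  have hK0 : 0 < K := lt_of_le_of_lt (by positivity) hK
  -- If all elements of N with τ = 1 have norm above K, then τ restricted to N has norm at most 1 /
  -- K.
  obtain ⟨φ, hφ, hφτ⟩ := exists_extension_norm_le N τ hK0 hcon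
  have h1 : bilinLeft 𝕜 A (∑ i, r i * s i) (tensorForm φ σ ρ) = tensorForm φ σ ρ := by
    ext a b
    rw [bilinLeft_apply, tensorForm_apply, tensorForm_apply, hρ]
  -- The averaged tensor lies in N, where φ may be replaced by τ; since τ ignores the averaging, the
  -- averaged form is ψ(xy).
  have h2 : ∑ i, bilinRight 𝕜 A (r i) (bilinLeft 𝕜 A (s i) (tensorForm φ σ ρ)) =
      mulForm 𝕜 A ψ := by
    ext a b
    rw [sum_apply, sum_apply, mulForm_apply, ← hψ, ← hτ, ← hφτ _ (hN _), projMapSum_ptmul,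
      map_sum]
    refine Finset.sum_congr rfl fun i _ => ?_
    rw [bilinRight_apply, bilinLeft_apply, tensorForm_apply, hS, hT]
  have h3 : M.functional (tensorForm φ σ ρ) = 1 := by
    rw [M.apply_eq_sum r s h1, h2]
    exact hMψ
  have h4 : ‖M.functional (tensorForm φ σ ρ)‖ ≤ m * (K⁻¹ * (‖σ‖ * ‖ρ‖)) :=
    (M.functional.le_opNorm_of_le ((norm_tensorForm_le φ σ ρ).trans (by gcongr))).trans
      (mul_le_mul_of_nonneg_right M.norm_le (by positivity))
  rw [h3, norm_one] at h4
  have h5 : m * (K⁻¹ * (‖σ‖ * ‖ρ‖)) = K⁻¹ * (m * (‖σ‖ * ‖ρ‖)) := by ring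
  rw [h5, le_inv_mul_iff₀ hK0, mul_one] at h4
  linarith

/-- An amenable Banach algebra with a bounded approximate identity `e` of idempotents has a central
functional whose value at the form `(x, y) ↦ ψ (x y)` is the limit of `ψ (e i)`. -/
theorem exists_centralFunctional {𝕜 : Type v} [RCLike 𝕜] {A : Type u} [NonUnitalNormedRing A]
    [NormedSpace 𝕜 A] [IsScalarTower 𝕜 A A] [SMulCommClass 𝕜 A A] {ι : Type*}
    (hA : IsAmenable 𝕜 A) (U : Ultrafilter ι) {e : ι → A} {C : ℝ}
    (hC : ∀ i, ‖e i‖ ≤ C) (he : ∀ i, IsIdempotentElem (e i))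
    (hl : ∀ a, Tendsto (fun i => e i * a) U (𝓝 a))
    (hr : ∀ a, Tendsto (fun i => a * e i) U (𝓝 a)) :
    ∃ (m : ℝ) (M : CentralFunctional 𝕜 A m), 0 ≤ m ∧
      ∀ ψ : StrongDual 𝕜 A, Tendsto (fun i => ψ (e i)) U (𝓝 (M.mulValue ψ)) := by
  obtain ⟨M, hM, hψ⟩ := exists_virtual_diagonal hA U hC he hl hr
  exact ⟨‖M‖, ⟨M, hM, le_rfl⟩, norm_nonneg M, hψ⟩

end VirtualDiagonal

/-! ### Compressing A(X) to the range of a projection -/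

section Compression

variable {𝕜 : Type*} [RCLike 𝕜] {X : Type*} [NormedAddCommGroup X] [NormedSpace 𝕜 X]
  [CompleteSpace X]

/-- The inclusion of `A(X)` in the bounded operators. -/
def approxIncl (𝕜 : Type*) [RCLike 𝕜] (X : Type*) [NormedAddCommGroup X] [NormedSpace 𝕜 X] :
    approximable 𝕜 X →L[𝕜] X →L[𝕜] X :=
  LinearMap.mkContinuous
    { toFun := Subtype.val, map_add' := fun _ _ => rfl, map_smul' := fun _ _ => rfl } 1
    fun a => (one_mul ‖a‖).symm.le

/-- The compression `a ↦ P a` from `A(X)` to `F(X, P(X))`. -/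
def compressLeft (p : ApproxProj 𝕜 X) : approximable 𝕜 X →L[𝕜] finiteRank 𝕜 X p.rg :=
  ((ContinuousLinearMap.compL 𝕜 X X p.rg p.proj).comp (approxIncl 𝕜 X)).codRestrict
    (finiteRank 𝕜 X p.rg) fun _ => mem_finiteRank_of_codom _

/-- The restriction of the operators in `A(X)` to `P(X)`. -/
def compressRight (p : ApproxProj 𝕜 X) : approximable 𝕜 X →L[𝕜] finiteRank 𝕜 p.rg X :=
  (((ContinuousLinearMap.compL 𝕜 p.rg X X).flip p.incl).comp (approxIncl 𝕜 X)).codRestrict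
    (finiteRank 𝕜 p.rg X) fun _ => mem_finiteRank_of_dom _

theorem norm_compressLeft_le (p : ApproxProj 𝕜 X) : ‖compressLeft p‖ ≤ ‖p.op‖ := by
  refine ContinuousLinearMap.opNorm_le_bound _ (norm_nonneg _) fun a => ?_
  change ‖p.proj.comp a.1‖ ≤ ‖p.op‖ * ‖a.1‖
  exact (ContinuousLinearMap.opNorm_comp_le _ _).trans
    (mul_le_mul_of_nonneg_right p.norm_proj_le (norm_nonneg _))

theorem norm_compressRight_le (p : ApproxProj 𝕜 X) : ‖compressRight p‖ ≤ 1 := by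
  refine ContinuousLinearMap.opNorm_le_bound _ zero_le_one fun a => ?_
  change ‖a.1.comp p.incl‖ ≤ 1 * ‖a.1‖
  refine (ContinuousLinearMap.opNorm_comp_le _ _).trans ?_
  rw [mul_comm]
  exact mul_le_mul_of_nonneg_right p.norm_incl_le (norm_nonneg _)

/-- Together with its right-hand analogue, this turns the module actions on bilinear forms into the
averaging operator on tensors. -/
theorem compressLeft_corner_mul (p : ApproxProj 𝕜 X) (W : p.rg →L[𝕜] p.rg)
    (a : approximable 𝕜 X) :
    compressLeft p (corner p p W * a) = postcomp W (compressLeft p a) :=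
  Subtype.ext (ContinuousLinearMap.ext fun _ => p.proj_coe _)

theorem compressRight_mul_corner (p : ApproxProj 𝕜 X) (W : p.rg →L[𝕜] p.rg)
    (a : approximable 𝕜 X) :
    compressRight p (a * corner p p W) = precomp W (compressRight p a) :=
  Subtype.ext (ContinuousLinearMap.ext fun x =>
    congrArg (fun y : p.rg => a.1 (W y : X)) (p.proj_coe x))

theorem compressRight_mul_self (p : ApproxProj 𝕜 X) (a : approximable 𝕜 X) :
    compressRight p (a * p.1) = compressRight p a :=
  Subtype.ext (ContinuousLinearMap.ext fun x => congrArg a.1 (p.op_coe x))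

/-- Since (bᵢ ⊗ f)(u ⊗ bᵢ*) = f(u) bᵢ ⊗ bᵢ*, the products add up to the identity of the range. -/
theorem sum_corner_mul_corner (p : ApproxProj 𝕜 X) {u : p.rg} {f : StrongDual 𝕜 p.rg}
    (hu : f u = 1) :
    ∑ i, corner p p (f.smulRight (Module.finBasis 𝕜 p.rg i)) *
      corner p p ((coordL 𝕜 p.rg i).smulRight u) = p.1 := by
  have h1 : ∀ i, corner p p (f.smulRight (Module.finBasis 𝕜 p.rg i)) *
      corner p p ((coordL 𝕜 p.rg i).smulRight u) =
        corner p p ((coordL 𝕜 p.rg i).smulRight (Module.finBasis 𝕜 p.rg i)) := fun i => by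
    rw [← corner_comp]
    congr 1
    ext x
    simp [hu]
  rw [Finset.sum_congr rfl fun i _ => h1 i, ← map_sum, ← corner_id p]
  congr 1
  ext x
  rw [sum_apply]
  exact congrArg Subtype.val (sum_coordL_smul x)

/-- The functional `a ↦ f (P a u)` on `A(X)`. -/
def cornerFunctional (p : ApproxProj 𝕜 X) (u : p.rg) (f : StrongDual 𝕜 p.rg) :
    StrongDual 𝕜 (approximable 𝕜 X) :=
  ((f.comp p.proj).comp (ContinuousLinearMap.apply 𝕜 X (u : X))).comp (approxIncl 𝕜 X)

/-- A central functional of `A(X)` yields a central tensor for the operators on the range of a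
projection. -/
theorem exists_centralTensor {m : ℝ} (hm : 0 ≤ m)
    (M : CentralFunctional 𝕜 (approximable 𝕜 X) m) (p : ApproxProj 𝕜 X) [CompleteSpace p.rg]
    {u : p.rg} {f : StrongDual 𝕜 p.rg} (hu : f u = 1)
    (hMψ : M.mulValue (cornerFunctional p u f) = 1) {K : ℝ} (hK : m * ‖p.op‖ < K) :
    ∃ Δ ∈ centralTensors 𝕜 p.rg X, evalProd u f Δ = 1 ∧ ‖Δ‖ ≤ K := by
  have hsum := sum_corner_mul_corner p hu
  have hnorm : ‖compressLeft p‖ * ‖compressRight p‖ ≤ ‖p.op‖ :=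
    (mul_le_mul (norm_compressLeft_le p) (norm_compressRight_le p) (norm_nonneg _)
      (norm_nonneg _)).trans (mul_one _).le
  exact M.exists_mem (F := finiteRank 𝕜 X p.rg) (G := finiteRank 𝕜 p.rg X)
    (r := fun i => corner p p (f.smulRight (Module.finBasis 𝕜 p.rg i)))
    (s := fun i => corner p p ((coordL 𝕜 p.rg i).smulRight u))
    (σ := compressLeft p) (ρ := compressRight p)
    (S := fun i => postcomp (f.smulRight (Module.finBasis 𝕜 p.rg i)))
    (T := fun i => precomp ((coordL 𝕜 p.rg i).smulRight u))
    (fun b => (congrArg (fun a => compressRight p (b * a)) hsum).trans (compressRight_mul_self p b))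
    (fun i a => compressLeft_corner_mul p _ a) (fun i b => compressRight_mul_corner p _ b)
    (N := centralTensors 𝕜 p.rg X) (average_mem u f) (τ := evalProd u f) (evalProd_average hu)
    (ψ := cornerFunctional p u f)
    (fun a b => evalProd_ptmul u f (compressLeft p a) (compressRight p b)) hMψ
    ((mul_le_mul_of_nonneg_left hnorm hm).trans_lt hK)

end Compression

/-! ### From amenability to generalized diagonals -/

section Diagonals

variable {𝕜 : Type*} [RCLike 𝕜] {X : Type*} [NormedAddCommGroup X] [NormedSpace 𝕜 X]

theorem isGeneralizedDiagonal_of_central {Y Z : Type*} [NormedAddCommGroup Y] [NormedSpace 𝕜 Y]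
    [NormedAddCommGroup Z] [NormedSpace 𝕜 Z] [FiniteDimensional 𝕜 Y] [FiniteDimensional 𝕜 Z]
    [CompleteSpace Y] (𝒜 : NonUnitalSubalgebra 𝕜 (Y →L[𝕜] Y)) {u : Y} {f : StrongDual 𝕜 Y}
    (hu : f u = 1) {Δ : ProjTensor 𝕜 (finiteRank 𝕜 Z Y) (finiteRank 𝕜 Y Z)}
    (hΔ : Δ ∈ centralTensors 𝕜 Y Z) (h1 : evalProd u f Δ = 1) : IsGeneralizedDiagonal 𝒜 Δ := by
  refine ⟨fun W _ => hΔ W, fun W _ => ?_⟩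
  rw [prodMap_eq_smul_of_central hu hΔ, h1, one_smul, ContinuousLinearMap.id_comp]

theorem isGeneralizedDiagonal_of_subsingleton {Y Z : Type*} [NormedAddCommGroup Y]
    [NormedSpace 𝕜 Y] [NormedAddCommGroup Z] [NormedSpace 𝕜 Z] [FiniteDimensional 𝕜 Y]
    [FiniteDimensional 𝕜 Z] [Subsingleton Y] (𝒜 : NonUnitalSubalgebra 𝕜 (Y →L[𝕜] Y)) :
    IsGeneralizedDiagonal 𝒜 (0 : ProjTensor 𝕜 (finiteRank 𝕜 Z Y) (finiteRank 𝕜 Y Z)) :=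
  ⟨fun _ _ => (map_zero _).trans (map_zero _).symm, fun _ _ => Subsingleton.elim _ _⟩

theorem exists_mem_apply_eq_one {V : Type*} [NormedAddCommGroup V] [NormedSpace 𝕜 V]
    (N : Submodule 𝕜 V) (τ : StrongDual 𝕜 V) {v : V} (hv : v ∈ N) (hτ : 1 / 2 < ‖τ v‖) {R : ℝ}
    (hR : ‖v‖ ≤ R) : ∃ w ∈ N, τ w = 1 ∧ ‖w‖ ≤ 2 * R := by
  have hc : 0 < ‖τ v‖ := by linarith
  refine ⟨(τ v)⁻¹ • v, N.smul_mem _ hv, ?_, ?_⟩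
  · rw [map_smul, smul_eq_mul, inv_mul_cancel₀ (norm_pos_iff.1 hc)]
  · have h2 : ‖(τ v)⁻¹‖ ≤ 2 := by
      rw [norm_inv, inv_le_comm₀ hc two_pos]
      linarith
    rw [norm_smul]
    exact mul_le_mul h2 hR (norm_nonneg _) zero_le_two

theorem exists_half_lt_norm {ι : Type*} {l : Filter ι} [l.NeBot] {g : ι → 𝕜}
    (hg : Tendsto g l (𝓝 1)) : ∃ i, 1 / 2 < ‖g i‖ := by
  have h := hg.norm
  rw [norm_one] at h
  exact (h.eventually (lt_mem_nhds one_half_lt_one)).exists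

theorem norm_truncate_incl_proj_le {p : ApproxProj 𝕜 X} {C : ℝ} (hp : ‖p.op‖ ≤ C) {Y : Type*}
    [NormedAddCommGroup Y] [NormedSpace 𝕜 Y]
    (Δ : ProjTensor 𝕜 (finiteRank 𝕜 X Y) (finiteRank 𝕜 Y X)) :
    ‖truncate Y p.incl p.proj Δ‖ ≤ C * ‖Δ‖ := by
  refine (norm_truncate_apply_le _ _ Δ).trans (mul_le_mul_of_nonneg_right ?_ (norm_nonneg _))
  have h2 := p.norm_incl_le
  have h3 := p.norm_proj_le.trans hp
  calc ‖p.incl‖ * ‖p.proj‖ ≤ 1 * C := by gcongr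
    _ = C := one_mul C

set_option maxHeartbeats 1000000 in
/-- A central tensor over `X` can be truncated to a generalized diagonal. -/
theorem exists_isGeneralizedDiagonal_of_central [CompleteSpace X] {ι : Type*} {l : Filter ι}
    [l.NeBot] (P : ι → ApproxProj 𝕜 X) {C : ℝ} (hC0 : 0 ≤ C) (hC : ∀ i, ‖(P i).op‖ ≤ C)
    (hP : ∀ x, Tendsto (fun i => (P i).op x) l (𝓝 x)) {Y : Type*} [NormedAddCommGroup Y]
    [NormedSpace 𝕜 Y] [FiniteDimensional 𝕜 Y] [CompleteSpace Y]
    (𝒜 : NonUnitalSubalgebra 𝕜 (Y →L[𝕜] Y)) {u : Y} {f : StrongDual 𝕜 Y} (hu : f u = 1)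
    {Δ : ProjTensor 𝕜 (finiteRank 𝕜 X Y) (finiteRank 𝕜 Y X)} (hΔ : Δ ∈ centralTensors 𝕜 Y X)
    (h1 : evalProd u f Δ = 1) :
    ∃ j, ∃ Γ : ProjTensor 𝕜 (finiteRank 𝕜 (P j).rg Y) (finiteRank 𝕜 Y (P j).rg),
      IsGeneralizedDiagonal 𝒜 Γ ∧ ‖Γ‖ ≤ 2 * (C * ‖Δ‖) := by
  -- The truncated values tend to 1, so some j gives a value above 1/2 in modulus; rescaling it to 1
  -- costs a factor 2.
  obtain ⟨j, hj⟩ := exists_half_lt_norm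
    (h1 ▸ tendsto_evalProd_truncate P hC0 hC hP u f Δ : Tendsto _ l (𝓝 (1 : 𝕜)))
  obtain ⟨Γ, hΓ, hΓ1, hΓn⟩ := exists_mem_apply_eq_one
    (V := ProjTensor 𝕜 (finiteRank 𝕜 (P j).rg Y) (finiteRank 𝕜 Y (P j).rg))
    (centralTensors 𝕜 Y (P j).rg) (evalProd u f)
    (truncate_mem_centralTensors (P j).incl (P j).proj hΔ) hj
    (norm_truncate_incl_proj_le (hC j) Δ)
  exact ⟨j, Γ, isGeneralizedDiagonal_of_central 𝒜 hu hΓ hΓ1, hΓn⟩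

/-- If `A(X)` is amenable, then the operators on the ranges of the projections of a bounded
approximate identity have generalized diagonals of bounded norm. -/
theorem exists_diagonals_of_isAmenable [CompleteSpace X] {ι : Type*} (U : Ultrafilter ι)
    (P : ι → ApproxProj 𝕜 X) {C : ℝ} (hC : ∀ i, ‖(P i).op‖ ≤ C)
    (hP : ∀ x, Tendsto (fun i => (P i).op x) U (𝓝 x))
    (hl : ∀ a : approximable 𝕜 X, Tendsto (fun i => (P i).1 * a) U (𝓝 a))
    (hr : ∀ a : approximable 𝕜 X, Tendsto (fun i => a * (P i).1) U (𝓝 a))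
    (hA : IsAmenable 𝕜 (approximable 𝕜 X)) :
    ∃ K : ℝ, 0 < K ∧ ∀ i, ∃ j, ∃ Δ : ProjTensor 𝕜 (finiteRank 𝕜 (P j).rg (P i).rg)
      (finiteRank 𝕜 (P i).rg (P j).rg),
        IsGeneralizedDiagonal (finiteRankAlg 𝕜 (P i).rg) Δ ∧ ‖Δ‖ ≤ K := by
  obtain ⟨i₀⟩ : Nonempty ι := U.neBot.nonempty
  have hC0 : 0 ≤ C := (norm_nonneg _).trans (hC i₀)
  obtain ⟨m, M, hm, hψ⟩ := exists_centralFunctional hA U (e := fun i => (P i).1) hC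
    (fun i => (P i).2) hl hr
  -- The bound m * C + 1 meets the strict inequality in the Hahn–Banach step, truncation costs C and
  -- rescaling 2. The last 1 ensures positivity even if C = 0.
  refine ⟨2 * (C * (m * C + 1)) + 1, by positivity, fun i => ?_⟩
  have : CompleteSpace (P i).rg := FiniteDimensional.complete 𝕜 (P i).rg
  -- A zero range admits no pair with f(u) = 1; there the zero tensor is a generalized diagonal.
  rcases subsingleton_or_nontrivial (P i).rg with hs | hn
  · refine ⟨i, 0, isGeneralizedDiagonal_of_subsingleton _, ?_⟩
    rw [norm_zero]
    positivity
  obtain ⟨u, hu0⟩ := exists_ne (0 : (P i).rg)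
  obtain ⟨f, hu⟩ := SeparatingDual.exists_eq_one (R := 𝕜) hu0
  -- The value is the limit of f(P_i P_j u), which is f(u) because P_j u → u.
  have hMψ : M.mulValue (cornerFunctional (P i) u f) = 1 := by
    refine tendsto_nhds_unique (hψ _) ?_
    have h1 : Tendsto (fun j => f ((P i).proj ((P j).op u))) U (𝓝 (f ((P i).proj u))) :=
      ((f.comp (P i).proj).continuous.tendsto _).comp (hP u)
    rw [(P i).proj_coe, hu] at h1
    exact h1
  obtain ⟨Δ, hΔ, h1, hΔn⟩ := exists_centralTensor hm M (P i) hu hMψ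
    (K := m * C + 1) (by nlinarith [mul_le_mul_of_nonneg_left (hC i) hm])
  obtain ⟨j, Γ, hΓ, hΓn⟩ := exists_isGeneralizedDiagonal_of_central P hC0 hC hP
    (finiteRankAlg 𝕜 (P i).rg) hu hΔ h1
  refine ⟨j, Γ, hΓ, hΓn.trans ?_⟩
  have h2 := mul_le_mul_of_nonneg_left hΔn hC0
  linarith

end Diagonals

end

end GenDiag

/-! ### The equivalence for a net -/

theorem mainTheorem3 {𝕜 : Type*} [RCLike 𝕜] {X : Type*} [NormedAddCommGroup X]
    [NormedSpace 𝕜 X] [CompleteSpace X]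
    {ι : Type*} [Preorder ι] [IsDirectedOrder ι] [Nonempty ι]
    (P : ι → GenDiag.ApproxProj 𝕜 X)
    (hbdd : ∃ C : ℝ, ∀ α, ‖(P α).op‖ ≤ C)
    (hP : ∀ x : X, Filter.Tendsto (fun α => (P α).op x) Filter.atTop (𝓝 x))
    (hP' : ∀ f : StrongDual 𝕜 X,
      Filter.Tendsto (fun α => f.comp (P α).op) Filter.atTop (𝓝 f)) :
    GenDiag.IsAmenable 𝕜 (GenDiag.approximable 𝕜 X) ↔
      ∃ K : ℝ, 0 < K ∧ ∀ α, ∃ β,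
        ∃ Δ : GenDiag.ProjTensor 𝕜 (GenDiag.finiteRank 𝕜 (P β).rg (P α).rg)
            (GenDiag.finiteRank 𝕜 (P α).rg (P β).rg),
          GenDiag.IsGeneralizedDiagonal (GenDiag.finiteRankAlg 𝕜 (P α).rg) Δ ∧ ‖Δ‖ ≤ K := by
  obtain ⟨C, hC⟩ := hbdd
  -- An ultrafilter finer than the net inherits its convergence and provides the weak-* limits used
  -- in both directions.
  have hU : ((Ultrafilter.of (atTop : Filter ι) : Ultrafilter ι) : Filter ι) ≤ atTop :=
    Ultrafilter.of_le atTop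
  have hl : ∀ a : GenDiag.approximable 𝕜 X,
      Tendsto (fun i => (P i).1 * a) (Ultrafilter.of (atTop : Filter ι)) (𝓝 a) := fun a =>
    tendsto_subtype_rng.2 ((GenDiag.tendsto_comp_of_approximable hC hP a.2).mono_left hU)
  have hr : ∀ a : GenDiag.approximable 𝕜 X,
      Tendsto (fun i => a * (P i).1) (Ultrafilter.of (atTop : Filter ι)) (𝓝 a) := fun a =>
    tendsto_subtype_rng.2 ((GenDiag.tendsto_approximable_comp hC hP' a.2).mono_left hU)
  constructor
  · exact GenDiag.exists_diagonals_of_isAmenable _ P hC (fun x => (hP x).mono_left hU) hl hr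
  · rintro ⟨K, -, h⟩
    exact GenDiag.isAmenable_of_diagonals _ P hC hl hr h
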